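/- **Proposition (dispersionless Lax and Orlov–Schulman functions in the Toda picture).** Let $N\ge 1$, $\mathcal S=\{1,\dots,N\}\cup\{\bar 1,\dots,\bar N\}$, $\operatorname{sg}(k)=1$, $\operatorname{sg}(\bar k)=-1$, and fix $a_0\in\mathcal S\setminus\{1\}$. All series are formal. *Setting.* For small $\epsilon>0$ let $S=1+\sum_{j\ge1}\varphi_j(n)\Lambda^{-j}$ and $\bar S=\sum_{j\ge0}\bar\varphi_j(n)\Lambda^{j}$ ($\bar\varphi_0$ invertible) be a solution of the $N$-component 2D Toda hierarchy: with $W=S\,W_0$, $\bar W=\bar S\,\bar W_0$, $W_0=\sum_kE_{kk}\Lambda^{s_k}\exp(\sum_{j\ge1}t_{jk}\Lambda^j)$, $\bar W_0=\sum_kE_{kk}\Lambda^{-s_{\bar k}}\exp(\sum_{j\ge1}t_{j\bar k}\Lambda^{-j})$, the operator $g=W^{-1}\bar W$ does not depend on $(\boldsymbol s,\boldsymbol t)$, i.e. $W$ and $\bar W$ have the same logarithmic derivatives $(\partial_{ja}W)W^{-1}=(\partial_{ja}\bar W)\bar W^{-1}$ and the same logarithmic differences $(T_{(a,b)}W)W^{-1}=(T_{(a,b)}\bar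 W)\bar W^{-1}$, where $T_{(a,b)}$ shifts $(s_a,s_b)$ to $(s_a+1,s_b-1)$. Pass to slow variables $s_a\to \epsilon s_a$, $t_{ja}\to\epsilon t_{ja}$, again denoted $s_a,t_{ja}$, where $s_a\in\mathbb R$, $\sum_a s_a=0$, and only finitely many $t_{ja}\in\mathbb C$ are nonzero. Let $n=n_0(\epsilon)\in\mathbb Z$ with $\epsilon n_0(\epsilon)\to\nu$ (so $\nu=0$ if $n_0$ does not depend on $\epsilon$). Assume that the first-row wave functions $\Psi_b=(W\chi)_{1k}$ for $b=k$, $\Psi_b=(\bar W\chi)_{1k}$ for $b=\bar k$ ($\chi=z^n$) at $n=n_0(\epsilon)$ are quasi-classical, $\Psi_b=\exp(\mathscr S_b/\epsilon)$, with $$\mathscr S_b=(\epsilon n_0+\operatorname{sg}(b)s_b-\epsilon\nu_b)\log z+\sum_{j\ge1}t_{jb}z^{\operatorname{sg}(b)j}+\sum_{i\ge0}u_{b,i}(\epsilon,\boldsymbol s,\boldsymbol t)\,z^{-\operatorname{sg}(b)i},$$ where $\nu_b=1$ for $b\in\{2,\dots,N\}$, $\nu_b=0$ otherwise, $u_{1,0}=0$,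 and the $u_{b,i}$ are smooth up to $\epsilon=0$. Let $\mathscr S_{b,0}$ be the leading term of $\mathscr S_b$ as $\epsilon\to0$. Put $\partial/\partial\sigma_a=\partial/\partial s_a-\partial/\partial s_1$ for $a\ne1$, and $x=-\sigma_{a_0}$. *Conclusion.* 1. There are functions $q_a(\boldsymbol s,\boldsymbol t)$, $a\neq1$, with $\partial_{t_{11}}\mathscr S_{b,0}=e^{-\partial\mathscr S_{b,0}/\partial\sigma_a}+q_a$ for all $a\ne1$ and all $b\in\mathcal S$. Put $Q_a=q_a-q_{a_0}$ (so $Q_{a_0}=0$). 2. For every $b$ the relation $p=\exp(\partial_x\mathscr S_{b,0})|_{z=z_b}$ has exactly one formal solution $z_b=z_b(p)$ with $z_b^{\operatorname{sg}(b)}=\infty$ at $p=\infty$ ($b=1$), respectively at $p=Q_b$ ($b\ne1$), and $$z_b^{\operatorname{sg}(b)}=\begin{cases}p+\ell_{1,0}+O(p^{-1}),&p\to\infty,\ b=1,\\ \ell_{a_0,1}\,p^{-1}+O(1),&p\to0,\ b=a_0,\\ \dfrac{\ell_{b,1}}{p-Q_b}+O(1),&p\to Q_b,\ b\ne1,a_0,\end{cases}\qquad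 \ell_{b,1}\ne0 .$$ 3. The functions $m_b=z\,\partial_z\mathscr S_{b,0}|_{z=z_b}$ satisfy $$m_b=\nu+\operatorname{sg}(b)\Big(s_b+\sum_{j\ge1}j\,t_{jb}\,z_b^{\operatorname{sg}(b)j}\Big)+\begin{cases}\sum_{j\ge1}\mu_{1j}\,p^{-j},&b=1,\\ \sum_{j\ge1}\mu_{a_0j}\,p^{j},&b=a_0,\\ \sum_{j\ge1}\mu_{bj}\,(p-Q_b)^j,&b\ne1,a_0,\end{cases}$$ with coefficients $\mu_{bj}$ depending on $(\boldsymbol s,\boldsymbol t)$. 4. This is a solution of the genus-zero Whitham hierarchy with $2N$ punctures in the Toda picture: the punctures $\infty$ and $Q_a$ ($a\neq1$, with $Q_{a_0}=0$) are distinct, and for every $b$, taking the derivatives of $\mathscr S_{b,0}$ at fixed $z$ and then putting $z=z_b(p)$, $$\partial_x\mathscr S_{b,0}=\log p,\qquad \frac{\partial\mathscr S_{b,0}}{\partial\sigma_a}=-\log(p-Q_a)\ (a\ne1,a_0),\qquad \partial_{t_{ja}}\mathscr S_{b,0}=\Omega_{ja}(p)\ (j\ge1,\ a\in\mathcal S)$$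 (the first two modulo $2\pi i\mathbb Z$), where $\Omega_{ja}=\big(z_a^{\operatorname{sg}(a)j}\big)_{(a,+)}$ and $(\cdot)_{(a,+)}$ is the projection of the expansion at the puncture $a$ onto the span of $p^n$, $n\ge0$, for $a=1$, and of $(p-Q_a)^{-n}$, $n\ge1$, for $a\ne1$. Equivalently, $$d\mathscr S_{b,0}=m_b\,d\log z_b+\log p\,dx-\sum_{a\ne1,a_0}\log(p-Q_a)\,ds_a+\sum_{j\ge1,\,a\in\mathcal S}\Omega_{ja}\,dt_{ja}.$$ -/

import Mathlib

open Filter Topology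
open scoped ContDiff LaurentSeries

namespace MultiToda

noncomputable section

/-! ### Indices, discrete and continuous variables -/

/-- The index set `{1, …, N} ∪ {1bar, …, Nbar}`: `Sum.inl k` is the unbarred index number `k + 1`,
`Sum.inr k` is the barred index number `k + 1`. -/
abbrev Idx (N : ℕ) := Fin N ⊕ Fin N

/-- The distinguished unbarred index `1`. -/
def one {N : ℕ} [NeZero N] : Idx N := Sum.inl 0

/-- `sg a = 1` for unbarred and `-1` for barred indices. -/
def sg {N : ℕ} : Idx N → ℤ
  | Sum.inl _ => 1
  | Sum.inr _ => -1

/-- The slow variables `s = (s_a)` in the zero charge sector `∑ s_a = 0`. -/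
def ZeroCharge (N : ℕ) : Submodule ℝ (Idx N → ℝ) where
  carrier := {s | ∑ a, s a = 0}
  add_mem' := by
    intro s s' hs hs'
    simp only [Set.mem_ofPred_eq] at hs hs' ⊢
    simp [Finset.sum_add_distrib] at hs hs' ⊢
    linarith
  zero_mem' := by simp
  smul_mem' := by
    intro c s hs
    simp only [Set.mem_ofPred_eq] at hs ⊢
    simp only [Pi.smul_apply, smul_eq_mul, ← Finset.mul_sum, hs, mul_zero]

/-- The slow times `t_{ja}`, `j ≥ 1`, only finitely many of them nonzero. -/
abbrev Times (N : ℕ) := (ℕ+ × Idx N) →₀ ℂ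

/-- The points `(s, t)`. -/
abbrev Params (N : ℕ) := ZeroCharge N × Times N

/-- The charge preserving direction `e_a - e_b`. -/
def dir {N : ℕ} (a b : Idx N) : ZeroCharge N :=
  ⟨Pi.single a 1 - Pi.single b 1, by
    change ∑ c, (Pi.single a (1 : ℝ) - Pi.single b 1 : Idx N → ℝ) c = 0
    simp only [Pi.sub_apply, Finset.sum_sub_distrib, Finset.sum_pi_single', Finset.mem_univ, if_true,
      sub_self]⟩

/-- `(s_a, s_b) ↦ (s_a + h, s_b - h)`.  The basic shift `T_{(a,b)}` is `h = ε` in slow variables;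
the derivative at `h = 0` for `b = 1` is `∂/∂σ_a = ∂/∂s_a - ∂/∂s_1`. -/
def moveS {N : ℕ} (a b : Idx N) (h : ℝ) (x : Params N) : Params N :=
  (x.1 + h • dir a b, x.2)

/-- `t_{ja} ↦ t_{ja} + h`. -/
def moveT {N : ℕ} (j : ℕ+) (a : Idx N) (h : ℂ) (x : Params N) : Params N :=
  (x.1, x.2 + Finsupp.single (j, a) h)

/-- The finite-dimensional slice of `Params N` on which only the times in `F` are switched on. -/
def slice {N : ℕ} (F : Finset (ℕ+ × Idx N)) (y : ZeroCharge N × (F → ℂ)) : Params N :=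
  (y.1, ∑ q : F, Finsupp.single (q : ℕ+ × Idx N) (y.2 q))

/-- `P ε y` holds for all small `ε > 0` and all `y` near `x`
(in every finite-dimensional slice through `x`). -/
def Near {N : ℕ} (x : Params N) (P : ℝ → Params N → Prop) : Prop :=
  ∀ (F : Finset (ℕ+ × Idx N)) (y : ZeroCharge N × (F → ℂ)), slice F y = x →
    ∀ᶠ r : ℝ × (ZeroCharge N × (F → ℂ)) in 𝓝[>] (0 : ℝ) ×ˢ 𝓝 y, P r.1 (slice F r.2)

/-- `f ε y` is smooth in `(ε, y)` for `ε ≥ 0` small and `y` near `x`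
(in every finite-dimensional slice through `x`); so it has a Taylor expansion
`f₀ + ε f₁ + ε² f₂ + ⋯` at `ε = 0` with smooth coefficients. -/
def SmoothAtZero {N : ℕ} (x : Params N) (f : ℝ → Params N → ℂ) : Prop :=
  ∀ (F : Finset (ℕ+ × Idx N)) (y : ZeroCharge N × (F → ℂ)), slice F y = x →
    ContDiffWithinAt ℝ ∞ (fun r : ℝ × (ZeroCharge N × (F → ℂ)) => f r.1 (slice F r.2))
      (Set.Ici 0 ×ˢ Set.univ) (0, y)

/-! ### Formal operators and the multicomponent 2D Toda hierarchy -/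

/-- Formal operators `X = ∑_j X_j(n) Λ^j` with `N × N` matrix coefficients;
`X j n` is the coefficient `X_j(n)`, and `Λ` is the shift `n ↦ n + 1`. -/
abbrev Op (N : ℕ) := ℤ → ℤ → Matrix (Fin N) (Fin N) ℂ

/-- The product `(X_i(n) Λ^i) (Y_j(n) Λ^j) = X_i(n) Y_j(n + i) Λ^{i + j}`.  It is used only when
one of the factors has finitely many terms, so that all sums are finite. -/
def opMul {N : ℕ} (X Y : Op N) : Op N :=
  fun m n => ∑ᶠ i : ℤ, X i n * Y (m - i) (n + i)

/-- The operator `E_{kk} Λ^j`. -/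
def diagShift {N : ℕ} (k : Fin N) (j : ℤ) : Op N :=
  fun i _ => if i = j then Matrix.single k k 1 else 0

/-- The group `G_-`: operators `1 + ∑_{j<0} X_j(n) Λ^j`. -/
def InGMinus {N : ℕ} (X : Op N) : Prop :=
  (∀ n, X 0 n = 1) ∧ ∀ j n, 0 < j → X j n = 0

/-- The group `G_+`: invertible operators `∑_{j≥0} X_j(n) Λ^j`. -/
def InGPlus {N : ℕ} (X : Op N) : Prop :=
  (∀ n, IsUnit (X 0 n)) ∧ ∀ j n, j < 0 → X j n = 0

/-- `X` only has the terms `X_i(n) Λ^i` with `|i| ≤ d`. -/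
def IsBanded {N : ℕ} (d : ℕ) (X : Op N) : Prop :=
  ∀ i n, (d : ℤ) < |i| → X i n = 0

/-- `∂_{ja} W₀ · W₀⁻¹` for `W₀ = ∑_k E_{kk} Λ^{s_k} exp (∑_j t_{jk} Λ^j)`. -/
def vacFlow {N : ℕ} (j : ℕ+) : Idx N → Op N
  | Sum.inl k => diagShift k (j : ℕ)
  | Sum.inr _ => 0

/-- `∂_{ja} W₀bar · W₀bar⁻¹` for
`W₀bar = ∑_k E_{kk} Λ^{-s_{kbar}} exp (∑_j t_{j kbar} Λ^{-j})`. -/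
def vacFlowBar {N : ℕ} (j : ℕ+) : Idx N → Op N
  | Sum.inl _ => 0
  | Sum.inr k => diagShift k (-((j : ℕ) : ℤ))

/-- `T_{(a,b)} W₀ · W₀⁻¹`. -/
def vacShift {N : ℕ} (a b : Idx N) : Op N :=
  ∑ k, diagShift k ((if a = Sum.inl k then 1 else 0) - (if b = Sum.inl k then 1 else 0))

/-- `T_{(a,b)} W₀bar · W₀bar⁻¹`. -/
def vacShiftBar {N : ℕ} (a b : Idx N) : Op N :=
  ∑ k, diagShift k ((if b = Sum.inr k then 1 else 0) - (if a = Sum.inr k then 1 else 0))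

/-- A family (in `ε > 0`) of solutions `S ∈ G_-`, `Sbar ∈ G_+` of the multicomponent 2D Toda
hierarchy, written in the slow variables `(s, t)` (a unit step of a discrete variable is a step
`ε`, the fast time derivatives are `ε ∂_{ja}`), near the points of `U` and at rows `n` at a finite
distance of `n₀ ε`.

For the dressing operators `W = S W₀`, `Wbar = Sbar W₀bar` the hierarchy says that
`g = W⁻¹ Wbar` (that is, `S W₀ g = Sbar W₀bar`) does not depend on the deformation parameters
`(s, t)`: `W` and `Wbar` have the same logarithmic derivatives
`B = (∂_{ja} W) W⁻¹ = (∂_{ja} Wbar) Wbar⁻¹` and the same logarithmic differences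
`T = (T_{(a,b)} W) W⁻¹ = (T_{(a,b)} Wbar) Wbar⁻¹`.  Below these identities are multiplied from the
right by `W W₀⁻¹ = S` and `Wbar W₀bar⁻¹ = Sbar`.  (The left expression for `B` has no powers of
`Λ` above `j`, and the right one none below `-j`, hence `B` is banded; similarly `T`.) -/
structure IsTodaSolution {N : ℕ} (n₀ : ℝ → ℤ) (U : Set (Params N)) (S Sbar : ℝ → Params N → Op N) :
    Prop where
  minus : ∀ ε x, InGMinus (S ε x)
  plus : ∀ ε x, InGPlus (Sbar ε x)
  flow : ∀ (j : ℕ+) (a : Idx N), ∃ B : ℝ → Params N → Op N,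
    (∀ ε x, IsBanded j (B ε x)) ∧
    ∀ x ∈ U, ∀ m i : ℤ, Near x fun ε y => ∀ l k : Fin N,
      HasDerivAt (fun h : ℂ => S ε (moveT j a h y) m (n₀ ε + i) l k)
        ((ε : ℂ)⁻¹ * (opMul (B ε y) (S ε y) m (n₀ ε + i) l k
          - opMul (S ε y) (vacFlow j a) m (n₀ ε + i) l k)) 0 ∧
      HasDerivAt (fun h : ℂ => Sbar ε (moveT j a h y) m (n₀ ε + i) l k)
        ((ε : ℂ)⁻¹ * (opMul (B ε y) (Sbar ε y) m (n₀ ε + i) l k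
          - opMul (Sbar ε y) (vacFlowBar j a) m (n₀ ε + i) l k)) 0
  disc : ∀ a b : Idx N, a ≠ b → ∃ T : ℝ → Params N → Op N,
    (∀ ε x, IsBanded 1 (T ε x)) ∧
    ∀ x ∈ U, ∀ m i : ℤ, Near x fun ε y =>
      opMul (S ε (moveS a b ε y)) (vacShift a b) m (n₀ ε + i)
        = opMul (T ε y) (S ε y) m (n₀ ε + i) ∧
      opMul (Sbar ε (moveS a b ε y)) (vacShiftBar a b) m (n₀ ε + i)
        = opMul (T ε y) (Sbar ε y) m (n₀ ε + i)

/-! ### Formal series and the quasi-classical ansatz -/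

/-- The exponential of a formal power series, `exp (f₀) · exp (f - f₀)`. -/
def expSeries (f : PowerSeries ℂ) : PowerSeries ℂ :=
  PowerSeries.C (Complex.exp (PowerSeries.constantCoeff f)) *
    (PowerSeries.exp ℂ).subst (f - PowerSeries.C (PowerSeries.constantCoeff f))

/-- The series in the local parameter `w = z^{-sg b}` which multiplies the vacuum factor in the
first-row wave function `Ψ_b` at row `n`:
`Ψ_1 = (1 + φ_{1,11} w + φ_{2,11} w² + ⋯) z^{n + s_1} exp (∑ t_{j1} z^j)`,
`Ψ_k = (φ_{1,1k} + φ_{2,1k} w + ⋯) z^{n + s_k - 1} exp (∑ t_{jk} z^j)` for `k ≠ 1`,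
`Ψ_{kbar} = (φbar_{0,1k} + φbar_{1,1k} w + ⋯) z^{n - s_{kbar}} exp (∑ t_{j kbar} z^{-j})`. -/
def rowSeries {N : ℕ} [NeZero N] (X Y : Op N) (n : ℤ) : Idx N → PowerSeries ℂ
  | Sum.inl k => PowerSeries.mk fun i => X (-((i : ℤ) + if k = 0 then 0 else 1)) n 0 k
  | Sum.inr k => PowerSeries.mk fun i => Y i n 0 k

/-- The quasi-classical ansatz `Ψ_b = exp (𝒮_b / ε)`, `𝒮_b = 𝒮_{b,0} + ε 𝒮_{b,1} + ⋯`, for the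
first row, where (with `w = z^{-sg b}`)
`𝒮_b = (ε n₀ + sg(b) s_b - ε ν_b) log z + ∑_j t_{jb} w^{-j} + ∑_{i ≥ 0} u b i ε (s, t) w^i`
with `ν_b = 1` for unbarred `b ≠ 1` and `ν_b = 0` otherwise. -/
structure IsQuasiClassical {N : ℕ} [NeZero N] (n₀ : ℝ → ℤ) (U : Set (Params N))
    (S Sbar : ℝ → Params N → Op N) (u : Idx N → ℕ → ℝ → Params N → ℂ) : Prop where
  smooth : ∀ x ∈ U, ∀ b i, SmoothAtZero x (u b i)
  normalized : ∀ ε x, u one 0 ε x = 0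
  ansatz : ∀ x ∈ U, ∀ b i, Near x fun ε y =>
    PowerSeries.coeff i (rowSeries (S ε y) (Sbar ε y) (n₀ ε) b)
      = PowerSeries.coeff i (expSeries (PowerSeries.mk fun i => u b i ε y / ε))

/-- A formal function `c log z + f(w)` near a puncture `b`, with `w = z^{-sg b}` and `f` a
Laurent series. -/
structure FormalPhase where
  log : ℂ
  tail : ℂ⸨X⸩

/-- The leading term
`𝒮_{b,0} = (ν + sg(b) s_b) log z + ∑_j t_{jb} w^{-j} + ∑_{i ≥ 0} u b i 0 (s, t) w^i`, where `ν` is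
the limit of `ε n₀`. -/
def leadingPhase {N : ℕ} (ν : ℝ) (u : Idx N → ℕ → ℝ → Params N → ℂ) (b : Idx N) (x : Params N) :
    FormalPhase where
  log := ν + sg b * ((x.1 : Idx N → ℝ) b : ℂ)
  tail := (x.2.sum fun q t => if q.2 = b then HahnSeries.single (-((q.1 : ℕ) : ℤ)) t else 0)
    + ((PowerSeries.mk fun i => u b i 0 x : PowerSeries ℂ) : ℂ⸨X⸩)

/-! ### Calculus of formal phases -/

/-- `z ∂_z (c log z + f(w)) = c - sg(b) w f'(w)`, because `w = z^{-sg b}`. -/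
def eulerZ {N : ℕ} (b : Idx N) (f : FormalPhase) : ℂ⸨X⸩ :=
  HahnSeries.C f.log
    - HahnSeries.C (sg b : ℂ) * (HahnSeries.single 1 1 * LaurentSeries.derivative ℂ f.tail)

/-- `D` is the derivative at `h = 0` of the family `f h` of formal phases, taken at fixed `z`,
when the coefficient of `log z` is constant. -/
def HasTimeDeriv (f : ℂ → FormalPhase) (D : ℂ⸨X⸩) : Prop :=
  HasDerivAt (fun h => (f h).log) 0 0 ∧
    ∀ n : ℤ, HasDerivAt (fun h => (f h).tail.coeff n) (D.coeff n) 0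

/-- `E = exp (-∂_h f)` at `h = 0`, the derivative taken at fixed `z`: if
`∂_h f = c log z + D(w)` with an integer `c` and a power series `D`, then
`exp (-∂_h f) = z^{-c} exp (-D) = w^{sg(b) c} exp (-D)`. -/
def HasExpNegDeriv {N : ℕ} (b : Idx N) (f : ℝ → FormalPhase) (E : ℂ⸨X⸩) : Prop :=
  ∃ (c : ℤ) (D : PowerSeries ℂ),
    HasDerivAt (fun h => (f h).log) (c : ℂ) 0 ∧
    (∀ n : ℤ, HasDerivAt (fun h => (f h).tail.coeff n) ((D : ℂ⸨X⸩).coeff n) 0) ∧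
    E = HahnSeries.single (sg b * c) 1 * (expSeries (-D) : ℂ⸨X⸩)

/-- The composition `f(w(τ))` of a Laurent series `f` with a power series `w` without constant
term. -/
def comp (f : ℂ⸨X⸩) (w : PowerSeries ℂ) : ℂ⸨X⸩ :=
  (w : ℂ⸨X⸩) ^ f.order * ((f.powerSeriesPart.subst w : PowerSeries ℂ) : ℂ⸨X⸩)

/-! ### The Toda picture -/

/-- The function `p` in the local parameter `τ` at the puncture `b`: `τ = 1 / p` for `b = 1` (where
`p = ∞`) and `τ = p - Q_b` for `b ≠ 1`. -/
def localP {N : ℕ} [NeZero N] (Q : Idx N → ℂ) (b : Idx N) : ℂ⸨X⸩ :=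
  if b = one then HahnSeries.single (-1) 1 else HahnSeries.C (Q b) + HahnSeries.single 1 1

/-- `w = z_b^{-sg b}`, as a series in the local parameter `τ` of `p` at the puncture `b`, is the
solution of the implicit relation `p = exp (∂_x 𝒮_{b,0}) = exp (-∂𝒮_{b,0}/∂σ_{a₀})` at `z = z_b`,
where `x = -σ_{a₀}`. -/
def IsLaxFunction {N : ℕ} [NeZero N] (a₀ : Idx N) (Q : Idx N → ℂ)
    (𝒮 : Idx N → Params N → FormalPhase) (x : Params N) (b : Idx N) (w : PowerSeries ℂ) : Prop :=
  PowerSeries.constantCoeff w = 0 ∧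
    ∃ P : ℂ⸨X⸩, HasExpNegDeriv b (fun h => 𝒮 b (moveS a₀ one h x)) P ∧ comp P w = localP Q b

/-- The Orlov–Schulman function `m_b = z ∂_z 𝒮_{b,0}` at `z = z_b`, as a Laurent series in the local
parameter of `p` at the puncture `b`. -/
def orlovSchulman {N : ℕ} (b : Idx N) (f : FormalPhase) (w : PowerSeries ℂ) : ℂ⸨X⸩ :=
  comp (eulerZ b f) w

/-- `Ω_{ja}(p) = (Z_a^j)_{(a,+)}`, where the Laurent series `Z a` is the local coordinate at the
puncture `a` (infinite at the puncture) in the local parameter of `p`, and `(·)_{(a,+)}` is the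
projection onto the span of `p^n`, `n ≥ 0`, for `a = 1` and of `(p - Q_a)^{-n}`, `n ≥ 1`, for
`a ≠ 1`.  The argument `p` may be any Laurent series; so `Ω_{ja}` can be expanded at every
puncture. -/
def Omega {N : ℕ} [NeZero N] (Q : Idx N → ℂ) (Z : Idx N → ℂ⸨X⸩) (j : ℕ) (a : Idx N) (p : ℂ⸨X⸩) :
    ℂ⸨X⸩ :=
  if a = one then
    ∑ n ∈ Finset.range (j + 1), HahnSeries.C ((Z a ^ j).coeff (-(n : ℤ))) * p ^ n
  else
    ∑ n ∈ Finset.Icc 1 j,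
      HahnSeries.C ((Z a ^ j).coeff (-(n : ℤ))) * ((p - HahnSeries.C (Q a))⁻¹) ^ n

/-- The data `(Q_a, Z_a)` (punctures and local coordinates `Z_a = 1 / w_a`, depending on the flow
parameters) are a solution of the genus-zero Whitham hierarchy with `2N` punctures in the Toda
picture, with the functions `𝒮_b` around the punctures: the punctures are `∞` (for `a = 1`),
`0` (for `a = a₀`) and `Q_a`, all distinct; `Z_1 = p + O(1)` at `∞` and `Z_a` has a simple pole
at `Q_a`; and, at fixed `z` and with `z = z_b(p)` inserted afterwards,
`∂𝒮_b/∂s_a = -log (p - Q_a)` for `a ≠ 1` (so, as `Q_{a₀} = 0`, `∂_x 𝒮_b = log p` with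
`x = -s_{a₀}`) and `∂_{ja} 𝒮_b = Ω_{ja}(p)` for all `j ≥ 1` and all `a`, at every puncture `b`.
The relations with logarithms are stated after exponentiation. -/
structure IsTodaWhithamSolution {N : ℕ} [NeZero N] (a₀ : Idx N) (U : Set (Params N))
    (Q : Params N → Idx N → ℂ) (w : Params N → Idx N → PowerSeries ℂ)
    (𝒮 : Idx N → Params N → FormalPhase) : Prop where
  origin : ∀ x ∈ U, Q x a₀ = 0
  distinct : ∀ x ∈ U, ∀ a b, a ≠ one → b ≠ one → a ≠ b → Q x a ≠ Q x b
  vanish : ∀ x ∈ U, ∀ b, PowerSeries.constantCoeff (w x b) = 0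
  simple : ∀ x ∈ U, ∀ b, PowerSeries.coeff 1 (w x b) ≠ 0
  monic : ∀ x ∈ U, PowerSeries.coeff 1 (w x one) = 1
  log_flow : ∀ x ∈ U, ∀ a b, a ≠ one → ∃ E : ℂ⸨X⸩,
    HasExpNegDeriv b (fun h => 𝒮 b (moveS a one h x)) E ∧
    comp E (w x b) = localP (Q x) b - HahnSeries.C (Q x a)
  time_flow : ∀ x ∈ U, ∀ (j : ℕ+) (a b : Idx N), ∃ D : ℂ⸨X⸩,
    HasTimeDeriv (fun h => 𝒮 b (moveT j a h x)) D ∧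
    comp D (w x b) = Omega (Q x) (fun c => (w x c : ℂ⸨X⸩)⁻¹) j a (localP (Q x) b)

end

end MultiToda

namespace MultiToda

noncomputable section

open PowerSeries

/-! ### Exponentials of formal power series -/

/-! Every flow acts on the first-row wave functions as a polynomial in one elementary shift, with
coefficients that do not depend on the puncture. Let `B` be the operator of the flow `t_{ja}` and
`A_i` that of `T_{(a,c)}^i`. Choose scalars `c_i` so that the first row of `(B - ∑ c_i A_i) S` has
only negative powers of `Λ` and that of `(B - ∑ c_i A_i) Sbar` only nonnegative ones. As `S` starts
with `1` and `Sbar` with an invertible matrix, that row of `B - ∑ c_i A_i` vanishes (`row_eq_zero`).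
The conditions on `c_i` concern only the puncture `a` and form a triangular system
(`sum_flowCoeff`); at the other punctures they hold automatically (`coeff_flowDefect_of_lt`).

Dividing by `exp (𝒮_b / ε)` turns `ε ∂_{ja}` into `∂_{ja} 𝒮_b` and the `i`-th power of a shift into
the exponential of a difference quotient, which tends to the `i`-th power of `exp (∂𝒮_{b,0})`. The
triangular system is continuous in its data, so the limit `ε → 0` exists coefficient by coefficient.
With `e^{-∂/∂σ_a}` for the inverse shift, `∂_{j1} 𝒮_{b,0}` becomes a polynomial in
`e^{-∂𝒮_{b,0}/∂σ_a}` for any `a ≠ 1`, and `∂_{ja} 𝒮_{b,0}` with `a ≠ 1` a polynomial without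
constant term in its inverse (`exists_timeTangent_eq_sum`).

The flow `t_{11}` gives `e^{-∂𝒮_{b,0}/∂σ_a} + q_a` for every `a ≠ 1`; comparing `a` with `a₀` gives
`e^{-∂𝒮_{b,0}/∂σ_a} = p - Q_a`. At the puncture `1` the function `1/p`, and at `b ≠ 1` the function
`p - Q_b`, is `w` times a unit, so it has a unique compositional inverse, the Lax function. For `a ≠
b` the function `p - Q_a` is a unit at `b ≠ 1`, whence the punctures are distinct. Finally the
coefficients of the polynomial for `t_{ja}` are read off at the puncture `a`, where `∂_{ja} 𝒮_{a,0}`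
is `z_a^{sg(a) j}` plus a regular term; this identifies it with `Ω_{ja}` at all punctures. -/

theorem constantCoeff_sub_C_constantCoeff (f : PowerSeries ℂ) :
    constantCoeff (f - C (constantCoeff f)) = 0 := by simp

theorem hasSubst_sub_constantCoeff (f : PowerSeries ℂ) :
    HasSubst (f - C (constantCoeff f)) :=
  HasSubst.of_constantCoeff_zero' (by simp)

theorem constantCoeff_expSeries (f : PowerSeries ℂ) :
    constantCoeff (expSeries f) = Complex.exp (constantCoeff f) := by
  have h : constantCoeff ((PowerSeries.exp ℂ).subst (f - C (constantCoeff f)) - 1) = 0 := by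
    have := constantCoeff_subst_eq_zero (a := f - C (constantCoeff f))
      (constantCoeff_sub_C_constantCoeff f)
      (PowerSeries.exp ℂ - 1) (by simp)
    rw [subst_sub (hasSubst_sub_constantCoeff f)] at this
    have h1 : (1 : PowerSeries ℂ).subst (f - C (constantCoeff f)) = (1 : PowerSeries ℂ) := by
      rw [← coe_substAlgHom (hasSubst_sub_constantCoeff f), map_one]
    rw [h1] at this
    exact this
  rw [map_sub, map_one, sub_eq_zero] at h
  rw [expSeries, map_mul, h]
  simp

theorem derivative_expSeries (f : PowerSeries ℂ) :
    d⁄dX ℂ (expSeries f) = expSeries f * d⁄dX ℂ f := by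
  rw [expSeries, Derivation.leibniz, derivative_subst (hasSubst_sub_constantCoeff f),
    derivative_exp]
  simp
  ring

theorem isUnit_expSeries (f : PowerSeries ℂ) : IsUnit (expSeries f) := by
  rw [isUnit_iff_constantCoeff, constantCoeff_expSeries]
  exact (Complex.exp_ne_zero _).isUnit

theorem eq_expSeries {f g : PowerSeries ℂ} (hd : d⁄dX ℂ g = g * d⁄dX ℂ f)
    (hc : constantCoeff g = Complex.exp (constantCoeff f)) : g = expSeries f := by
  obtain ⟨e, he⟩ := isUnit_expSeries f
  have key : g * (↑e⁻¹ : PowerSeries ℂ) = 1 := by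
    apply derivative.ext
    · rw [Derivation.leibniz, derivative_inv, hd, he, derivative_expSeries, ← he]
      have : (↑e⁻¹ : PowerSeries ℂ) * e = 1 := e.inv_mul
      simp only [smul_eq_mul, Derivation.map_one_eq_zero]
      linear_combination (-g * (↑e⁻¹ : PowerSeries ℂ) * d⁄dX ℂ f) * this
    · have h2 : constantCoeff ((e : PowerSeries ℂ) * (↑e⁻¹ : PowerSeries ℂ)) = 1 := by simp
      rw [map_mul, he, constantCoeff_expSeries] at h2
      rw [map_mul, hc, h2, map_one]
  rw [← he]
  calc g = g * (↑e⁻¹ : PowerSeries ℂ) * e := by rw [mul_assoc, e.inv_mul, mul_one]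
    _ = e := by rw [key, one_mul]

theorem expSeries_zero : expSeries 0 = 1 :=
  (eq_expSeries (by simp) (by simp)).symm

theorem expSeries_add (f g : PowerSeries ℂ) :
    expSeries (f + g) = expSeries f * expSeries g :=
  (eq_expSeries (by
    rw [Derivation.leibniz, derivative_expSeries, derivative_expSeries, map_add]
    simp only [smul_eq_mul]
    ring) (by
    rw [map_mul, constantCoeff_expSeries, constantCoeff_expSeries, map_add, Complex.exp_add])).symm

theorem expSeries_neg_mul (f : PowerSeries ℂ) : expSeries (-f) * expSeries f = 1 := by
  rw [← expSeries_add, neg_add_cancel, expSeries_zero]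

theorem expSeries_nsmul (n : ℕ) (f : PowerSeries ℂ) :
    expSeries (n • f) = expSeries f ^ n := by
  induction n with
  | zero => simp [expSeries_zero]
  | succ n ih => rw [succ_nsmul, expSeries_add, ih, pow_succ]

/-- The differential equation read as a recursion; it carries limits and derivatives of coefficients
through the exponential by strong induction. -/
theorem coeff_succ_expSeries (f : PowerSeries ℂ) (n : ℕ) :
    coeff (n + 1) (expSeries f) = ((n : ℂ) + 1)⁻¹ *
      ∑ p ∈ Finset.HasAntidiagonal.antidiagonal n,
        coeff p.1 (expSeries f) * (coeff (p.2 + 1) f * ((p.2 : ℂ) + 1)) := by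
  have h := congrArg (coeff n) (derivative_expSeries f)
  rw [coeff_derivative, coeff_mul] at h
  simp only [coeff_derivative] at h
  rw [← h]
  have : (n : ℂ) + 1 ≠ 0 := Nat.cast_add_one_ne_zero n
  field_simp

theorem tendsto_coeff_expSeries {ι : Type*} {l : Filter ι} {F : ι → PowerSeries ℂ}
    {f : PowerSeries ℂ} (h : ∀ n, Tendsto (fun i => coeff n (F i)) l (𝓝 (coeff n f))) (n : ℕ) :
    Tendsto (fun i => coeff n (expSeries (F i))) l (𝓝 (coeff n (expSeries f))) := by
  induction n using Nat.strong_induction_on with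
  | _ n ih =>
    cases n with
    | zero =>
      simp only [coeff_zero_eq_constantCoeff, constantCoeff_expSeries]
      exact (Complex.continuous_exp.tendsto _).comp (by simpa using h 0)
    | succ n =>
      simp only [coeff_succ_expSeries]
      refine Tendsto.const_mul _ (tendsto_finsetSum _ fun p hp => ?_)
      exact (ih _ (by have := Finset.HasAntidiagonal.mem_antidiagonal.1 hp; omega)).mul ((h _).mul_const _)

/-- Differentiating the recursion for `expSeries F` yields the recursion for `expSeries F * f'`. The
bound `M` is needed because, for a given small `ε`, only finitely many coefficients are under
control at once. -/
theorem hasDerivAt_coeff_expSeries {F : ℝ → PowerSeries ℂ} {f' : PowerSeries ℂ} {t : ℝ} {M : ℕ}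
    (h : ∀ n ≤ M, HasDerivAt (fun s => coeff n (F s)) (coeff n f') t) (n : ℕ) (hn : n ≤ M) :
    HasDerivAt (fun s => coeff n (expSeries (F s))) (coeff n (expSeries (F t) * f')) t := by
  induction n using Nat.strong_induction_on with
  | _ n ih =>
    cases n with
    | zero =>
      simp only [coeff_zero_eq_constantCoeff, constantCoeff_expSeries, map_mul]
      exact HasDerivAt.cexp (by simpa using h 0 (Nat.zero_le _))
    | succ n =>
      simp only [coeff_succ_expSeries]
      have key : coeff (n + 1) (expSeries (F t) * f') = ((n : ℂ) + 1)⁻¹ *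
          ∑ p ∈ Finset.HasAntidiagonal.antidiagonal n,
            (coeff p.1 (expSeries (F t) * f') * (coeff (p.2 + 1) (F t) * ((p.2 : ℂ) + 1)) +
              coeff p.1 (expSeries (F t)) * (coeff (p.2 + 1) f' * ((p.2 : ℂ) + 1))) := by
        have e : d⁄dX ℂ (expSeries (F t) * f')
            = (expSeries (F t) * f') * d⁄dX ℂ (F t) + expSeries (F t) * d⁄dX ℂ f' := by
          rw [Derivation.leibniz, derivative_expSeries]
          simp only [smul_eq_mul]
          ring
        have h := congrArg (coeff n) e
        rw [coeff_derivative, map_add, coeff_mul n (expSeries (F t) * f'),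
          coeff_mul n (expSeries (F t))] at h
        simp only [coeff_derivative] at h
        rw [Finset.sum_add_distrib, ← h]
        have : (n : ℂ) + 1 ≠ 0 := Nat.cast_add_one_ne_zero n
        field_simp
      rw [key]
      refine HasDerivAt.const_mul _ (HasDerivAt.fun_sum fun p hp => ?_)
      have hp := Finset.HasAntidiagonal.mem_antidiagonal.1 hp
      exact (ih _ (by omega) (by omega)).mul ((h _ (by omega)).mul_const _)

theorem coeff_eq_zero_of_isUnit_mul {g f : PowerSeries ℂ} (hg : IsUnit g) {M : ℕ}
    (h : ∀ n ≤ M, coeff n (g * f) = 0) (n : ℕ) (hn : n ≤ M) : coeff n f = 0 := by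
  obtain ⟨e, rfl⟩ := hg
  have : f = (↑e⁻¹ : PowerSeries ℂ) * (e * f) := by rw [← mul_assoc, e.inv_mul, one_mul]
  rw [this, coeff_mul]
  refine Finset.sum_eq_zero fun p hp => ?_
  have hp := Finset.HasAntidiagonal.mem_antidiagonal.1 hp
  rw [h p.2 (by omega), mul_zero]

/-! ### Triangular systems of power series -/

/-- The solution `c` of `∑_{k ≤ m} c_k coeff (m - k) (e_k) = t_m`, `m ≥ 0`. -/
def triangularSolution (e : ℕ → PowerSeries ℂ) (t : ℕ → ℂ) : ℕ → ℂ
  | n => (t n - ∑ k : Fin n, triangularSolution e t k * coeff (n - k) (e k))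
      / constantCoeff (e n)

theorem sum_triangularSolution (e : ℕ → PowerSeries ℂ) (t : ℕ → ℂ) (n : ℕ)
    (he : constantCoeff (e n) ≠ 0) :
    ∑ k ∈ Finset.range (n + 1), triangularSolution e t k * coeff (n - k) (e k) = t n := by
  rw [Finset.sum_range_succ, Nat.sub_self, coeff_zero_eq_constantCoeff]
  have : triangularSolution e t n
        = (t n - ∑ k : Fin n, triangularSolution e t k * coeff (n - k) (e k))
          / constantCoeff (e n) := by rw [triangularSolution]
  rw [this, div_mul_cancel₀ _ he, Finset.sum_range (fun k => triangularSolution e t k * coeff (n - k) (e k))]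
  ring

theorem tendsto_triangularSolution {ι : Type*} {l : Filter ι} {E : ι → ℕ → PowerSeries ℂ}
    {e : ℕ → PowerSeries ℂ} (t : ℕ → ℂ)
    (h : ∀ k n, Tendsto (fun i => coeff n (E i k)) l (𝓝 (coeff n (e k))))
    (he : ∀ k, constantCoeff (e k) ≠ 0) (n : ℕ) :
    Tendsto (fun i => triangularSolution (E i) t n) l (𝓝 (triangularSolution e t n)) := by
  induction n using Nat.strong_induction_on with
  | _ n ih =>
    have : ∀ e, triangularSolution e t n
        = (t n - ∑ k : Fin n, triangularSolution e t k * coeff (n - k) (e k))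
          / constantCoeff (e n) := fun e => by rw [triangularSolution]
    simp only [this]
    refine Tendsto.div (tendsto_const_nhds.sub (tendsto_finsetSum _ fun k _ => ?_))
      (by simpa using h n 0) (he n)
    exact (ih k k.2).mul (h _ _)

/-! ### Laurent series -/

theorem coeff_single_one_mul (c : ℤ) (f : ℂ⸨X⸩) (m : ℤ) :
    (HahnSeries.single c (1 : ℂ) * f).coeff m = f.coeff (m - c) := by
  rw [HahnSeries.coeff_single_mul, one_mul]

theorem coeff_coe_of_neg (f : PowerSeries ℂ) {m : ℤ} (hm : m < 0) : (f : ℂ⸨X⸩).coeff m = 0 := by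
  rw [coeff_coe, if_pos hm]

theorem coeff_coe_natCast (f : PowerSeries ℂ) (m : ℕ) : (f : ℂ⸨X⸩).coeff m = coeff m f :=
  LaurentSeries.coeff_coe_powerSeries f m

theorem coeff_mul_coe_eq_zero {f : ℂ⸨X⸩} (g : PowerSeries ℂ) {m : ℤ}
    (h : ∀ m' ≤ m, f.coeff m' = 0) : (f * (g : ℂ⸨X⸩)).coeff m = 0 := by
  rw [HahnSeries.coeff_mul]
  refine Finset.sum_eq_zero fun p hp => ?_
  rw [Finset.mem_antidiagonal] at hp
  by_cases h2 : p.2 < 0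
  · rw [coeff_coe_of_neg g h2, mul_zero]
  · rw [h p.1 (by omega), zero_mul]

theorem single_zpow_eq (n : ℤ) :
    (HahnSeries.single n (1 : ℂ) : ℂ⸨X⸩) = (HahnSeries.single 1 (1 : ℂ) : ℂ⸨X⸩) ^ n := by
  exact RatFunc.single_zpow n

/-! ### Composition with a power series -/

theorem coe_ne_zero_of_ne_zero {w : PowerSeries ℂ} (hw0 : w ≠ 0) : (w : ℂ⸨X⸩) ≠ 0 := by
  intro h
  exact hw0 (HahnSeries.ofPowerSeries_injective (h.trans (map_zero (HahnSeries.ofPowerSeries ℤ ℂ)).symm))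

/-- Laurent series are power series localized at `X`, so a substitution extends to them as soon as
the image of `X` is invertible. -/
theorem isUnit_coe_subst_X {w : PowerSeries ℂ} (hw : constantCoeff w = 0) (hw0 : w ≠ 0) :
    IsUnit (((HahnSeries.ofPowerSeries ℤ ℂ).comp
      (substAlgHom (R := ℂ) (HasSubst.of_constantCoeff_zero' hw)).toRingHom) X) := by
  have : (substAlgHom (R := ℂ) (HasSubst.of_constantCoeff_zero' hw)) X = w :=
    substAlgHom_X _
  refine IsUnit.mk0 _ ?_
  change HahnSeries.ofPowerSeries ℤ ℂ
    ((substAlgHom (R := ℂ) (HasSubst.of_constantCoeff_zero' hw)) X) ≠ 0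
  rw [this]
  exact coe_ne_zero_of_ne_zero hw0

/-- Composition with a nonzero power series without constant term, as a ring homomorphism. -/
def compHom {w : PowerSeries ℂ} (hw : constantCoeff w = 0) (hw0 : w ≠ 0) : ℂ⸨X⸩ →+* ℂ⸨X⸩ :=
  IsLocalization.Away.lift (X : PowerSeries ℂ) (isUnit_coe_subst_X hw hw0)

section Comp

variable {w : PowerSeries ℂ} (hw : constantCoeff w = 0) (hw0 : w ≠ 0)

theorem compHom_coe (g : PowerSeries ℂ) :
    compHom hw hw0 (g : ℂ⸨X⸩) = ((g.subst w : PowerSeries ℂ) : ℂ⸨X⸩) := by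
  have := IsLocalization.Away.lift_eq (S := ℂ⸨X⸩) (X : PowerSeries ℂ)
    (isUnit_coe_subst_X hw hw0) g
  rw [LaurentSeries.coe_algebraMap] at this
  rw [compHom, this]
  simp [← coe_substAlgHom (HasSubst.of_constantCoeff_zero' hw)]

theorem compHom_C (c : ℂ) : compHom hw hw0 (HahnSeries.C c) = HahnSeries.C c := by
  rw [← PowerSeries.coe_C, compHom_coe, ← coe_substAlgHom (HasSubst.of_constantCoeff_zero' hw)]
  congr 1
  exact (substAlgHom (R := ℂ) (HasSubst.of_constantCoeff_zero' hw)).commutes c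

theorem compHom_single (n : ℤ) :
    compHom hw hw0 (HahnSeries.single n 1) = (w : ℂ⸨X⸩) ^ n := by
  rw [single_zpow_eq, map_zpow₀, ← PowerSeries.coe_X, compHom_coe,
    subst_X (HasSubst.of_constantCoeff_zero' hw)]

/-- Makes `comp` multiplicative and additive in `f`, which is not visible from its definition
through the order of `f`. -/
theorem comp_eq_compHom (f : ℂ⸨X⸩) : comp f w = compHom hw hw0 f := by
  conv_rhs => rw [← LaurentSeries.single_order_mul_powerSeriesPart f]
  rw [map_mul, compHom_single, compHom_coe, comp]

end Comp

variable {N : ℕ}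

/-! ### Curves through a point of the parameter space -/

/-- The point obtained from `x` by moving the charges along `v` and the time `t_{ja}`. -/
def moved (v : ZeroCharge N) (j : ℕ+) (a : Idx N) (x : Params N) (r : ℝ × ℂ) : Params N :=
  (x.1 + r.1 • v, x.2 + Finsupp.single (j, a) r.2)

/-- `Near` and `SmoothAtZero` speak only of finite-dimensional slices. Switching on the support of
`x.2` together with `(j, a)` gives a slice in which the moved points depend affinely on `r`. -/
theorem exists_slice_moved (v : ZeroCharge N) (j : ℕ+) (a : Idx N) (x : Params N) :
    ∃ (F : Finset (ℕ+ × Idx N)) (y : ZeroCharge N × (F → ℂ))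
      (L : ℝ × ℂ →L[ℝ] ZeroCharge N × (F → ℂ)),
      slice F y = x ∧ ∀ r, slice F (y + L r) = moved v j a x r := by
  classical
  have key : ∀ (F : Finset (ℕ+ × Idx N)) (t : Times N), t.support ⊆ F →
      ∑ q : F, Finsupp.single (q : ℕ+ × Idx N) (t q) = t := by
    intro F t ht
    rw [Finset.sum_coe_sort F (fun q => Finsupp.single q (t q))]
    conv_rhs => rw [← Finsupp.sum_single t]
    exact (Finsupp.sum_of_support_subset t ht _ (by simp)).symm
  refine ⟨insert (j, a) x.2.support, (x.1, fun q => x.2 q),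
    ((ContinuousLinearMap.fst ℝ ℝ ℂ).smulRight v).prod (ContinuousLinearMap.pi fun q =>
      if (q : ℕ+ × Idx N) = (j, a) then ContinuousLinearMap.snd ℝ ℝ ℂ else 0), ?_, ?_⟩
  · exact Prod.ext rfl (key _ _ (Finset.subset_insert _ _))
  · intro r
    refine Prod.ext rfl ?_
    have h : (x.2 + Finsupp.single (j, a) r.2).support ⊆ insert (j, a) x.2.support := by
      refine Finsupp.support_add.trans (Finset.union_subset (Finset.subset_insert _ _) ?_)
      exact Finsupp.support_single_subset.trans (by simp)
    refine Eq.trans ?_ (key _ _ h)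
    refine Finset.sum_congr rfl fun q _ => ?_
    congr 1
    simp only [Prod.snd_add, Pi.add_apply, ContinuousLinearMap.prod_apply,
      ContinuousLinearMap.coe_pi', moved, Finsupp.add_apply]
    by_cases hq : (q : ℕ+ × Idx N) = (j, a)
    · simp [hq]
    · simp [hq]

theorem Near.eventually_moved {x : Params N} {P : ℝ → Params N → Prop} (h : Near x P)
    (v : ZeroCharge N) (j : ℕ+) (a : Idx N) :
    ∀ᶠ p : ℝ × (ℝ × ℂ) in 𝓝[>] (0 : ℝ) ×ˢ 𝓝 0, P p.1 (moved v j a x p.2) := by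
  obtain ⟨F, y, L, hy, hL⟩ := exists_slice_moved v j a x
  have h1 : Tendsto (fun r => y + L r) (𝓝 0) (𝓝 y) := by
    have : Continuous fun r => y + L r := by fun_prop
    simpa using this.tendsto 0
  have := (tendsto_id.prodMap h1).eventually (h F y hy)
  filter_upwards [this] with p hp
  simpa [hL] using hp

theorem Near.eventually_line {x : Params N} {P : ℝ → Params N → Prop} (h : Near x P)
    (v : ZeroCharge N) (a : Idx N) (i : ℕ) :
    ∀ᶠ ε in 𝓝[>] (0 : ℝ), P ε (x.1 + ((i : ℝ) * ε) • v, x.2) := by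
  have h1 : Tendsto (fun ε : ℝ => (ε, (((i : ℝ) * ε, 0) : ℝ × ℂ))) (𝓝[>] 0)
      (𝓝[>] (0 : ℝ) ×ˢ 𝓝 0) := by
    refine tendsto_id.prodMk (Tendsto.mono_left ?_ nhdsWithin_le_nhds)
    have : Continuous fun ε : ℝ => (((i : ℝ) * ε, 0) : ℝ × ℂ) := by fun_prop
    simpa [← Prod.zero_eq_mk] using this.tendsto 0
  filter_upwards [h1.eventually (h.eventually_moved v 1 a)] with ε hε
  simpa [moved] using hε

theorem Near.eventually_time {x : Params N} {P : ℝ → Params N → Prop} (h : Near x P)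
    (j : ℕ+) (a : Idx N) :
    ∀ᶠ ε in 𝓝[>] (0 : ℝ), ∀ᶠ z in 𝓝 (0 : ℂ), P ε (moveT j a z x) := by
  have h1 : Tendsto (fun z : ℂ => ((0, z) : ℝ × ℂ)) (𝓝 0) (𝓝 0) := by
    have : Continuous fun z : ℂ => ((0, z) : ℝ × ℂ) := by fun_prop
    simpa [← Prod.zero_eq_mk] using this.tendsto 0
  filter_upwards [(h.eventually_moved 0 j a).curry] with ε hε
  filter_upwards [h1.eventually hε] with z hz
  simpa [moved, moveT] using hz

theorem Near.eventually_self {x : Params N} {P : ℝ → Params N → Prop} (h : Near x P)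
    (a : Idx N) : ∀ᶠ ε in 𝓝[>] (0 : ℝ), P ε x := by
  filter_upwards [h.eventually_line 0 a 0] with ε hε
  simpa using hε

theorem SmoothAtZero.contDiffWithinAt_moved {x : Params N} {f : ℝ → Params N → ℂ}
    (h : SmoothAtZero x f) (v : ZeroCharge N) (j : ℕ+) (a : Idx N) :
    ContDiffWithinAt ℝ ∞ (fun p : ℝ × (ℝ × ℂ) => f p.1 (moved v j a x p.2))
      (Set.Ici 0 ×ˢ Set.univ) (0, 0) := by
  obtain ⟨F, y, L, hy, hL⟩ := exists_slice_moved v j a x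
  have h1 : ContDiff ℝ ∞ fun p : ℝ × (ℝ × ℂ) => (p.1, y + L p.2) := by fun_prop
  have := (h F y hy).comp_of_eq (x := ((0, 0) : ℝ × (ℝ × ℂ))) h1.contDiffWithinAt
    (s := Set.Ici 0 ×ˢ Set.univ)
    (fun p hp => ⟨hp.1, trivial⟩) (by simp)
  refine this.congr (fun p _ => ?_) ?_ <;> simp only [Function.comp_apply, hL]

/-- Joint differentiability at the corner `ε = 0`: a step `iε` along `v`, divided by `ε`, has the
limit `i` times the derivative of the leading term, and the corrections of order `ε` drop out. -/
theorem SmoothAtZero.exists_hasDerivAt_line {x : Params N} {f : ℝ → Params N → ℂ}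
    (h : SmoothAtZero x f) (v : ZeroCharge N) (a : Idx N) :
    ∃ d : ℂ, HasDerivAt (fun s : ℝ => f 0 (x.1 + s • v, x.2)) d 0 ∧
      ∀ i : ℕ, Tendsto (fun ε : ℝ => (f ε (x.1 + ((i : ℝ) * ε) • v, x.2) - f ε x) / ε)
        (𝓝[>] 0) (𝓝 (i * d)) := by
  have h1 := (h.contDiffWithinAt_moved v 1 a).differentiableWithinAt (by simp)
  obtain ⟨L, hL⟩ := h1
  refine ⟨L (0, (1, 0)), ?_, fun i => ?_⟩
  · have hc : HasDerivWithinAt (fun s : ℝ => ((0, (s, 0)) : ℝ × (ℝ × ℂ))) (0, (1, 0)) Set.univ 0 :=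
      ((hasDerivAt_const _ _).prodMk ((hasDerivAt_id _).prodMk
        (hasDerivAt_const _ _))).hasDerivWithinAt
    have := HasFDerivWithinAt.comp_hasDerivWithinAt_of_eq (0 : ℝ) hL hc
      (fun s _ => ⟨Set.self_mem_Ici, trivial⟩) rfl
    rw [hasDerivWithinAt_univ] at this
    simpa [moved, Function.comp_def] using this
  · have key : ∀ i : ℕ, HasDerivWithinAt (fun ε : ℝ => f ε (x.1 + ((i : ℝ) * ε) • v, x.2))
        (L (1, (i, 0))) (Set.Ici 0) 0 := by
      intro i
      have hc : HasDerivWithinAt (fun s : ℝ => ((s, ((i : ℝ) * s, 0)) : ℝ × (ℝ × ℂ)))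
          (1, (i, 0)) (Set.Ici 0) 0 :=
        ((hasDerivAt_id _).prodMk ((((hasDerivAt_id (0 : ℝ)).const_mul (i : ℝ)).congr_deriv (mul_one _)).prodMk
          (hasDerivAt_const _ _))).hasDerivWithinAt
      have := HasFDerivWithinAt.comp_hasDerivWithinAt_of_eq (0 : ℝ) hL hc
        (fun s hs => ⟨hs, trivial⟩) (by simp [← Prod.zero_eq_mk])
      simpa [moved, Function.comp_def] using this
    have h2 := hasDerivWithinAt_iff_tendsto_slope.1 ((key i).sub (key 0))
    -- The displaced and the undisplaced curve have the same velocity in `ε`, so only the component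
    -- along `v` survives.
    have e : L (1, ((i : ℝ), 0)) - L (1, (((0 : ℕ) : ℝ), 0)) = i * L (0, (1, 0)) := by
      rw [← map_sub]
      have : ((1, ((i : ℝ), 0)) - (1, (((0 : ℕ) : ℝ), 0)) : ℝ × (ℝ × ℂ))
          = (i : ℝ) • (0, (1, 0)) := by simp
      rw [this, map_smul]
      simp
    rw [e] at h2
    have hs : Set.Ici (0 : ℝ) \ {0} = Set.Ioi 0 := by simp
    rw [hs] at h2
    refine h2.congr fun ε => ?_
    simp only [slope_def_module, Pi.sub_apply]
    simp [div_eq_inv_mul]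

/-- The Cauchy–Riemann criterion: a real-linear map commuting with multiplication by `I` is complex
linear. -/
theorem hasDerivAt_of_real {f : ℂ → ℂ} {L : ℂ →L[ℝ] ℂ} {z : ℂ} (h : HasFDerivAt f L z)
    (hL : L Complex.I = Complex.I * L 1) : HasDerivAt f (L 1) z := by
  rw [hasDerivAt_iff_hasFDerivAt]
  refine hasFDerivAt_of_restrictScalars ℝ h ?_
  ext c
  have : L c = c.re • L 1 + c.im • L Complex.I := by
    rw [← map_smul, ← map_smul, ← map_add]
    congr 1
    simp
  rw [this, hL]
  simp only [Complex.real_smul, ContinuousLinearMap.coe_restrictScalars',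
    ContinuousLinearMap.toSpanSingleton_apply, smul_eq_mul]
  nth_rewrite 1 [← Complex.re_add_im c]
  ring

/-! ### Derivatives with respect to the times -/

/-- The series of the derivatives of `u 0, u 1, …` with respect to `t_{ja}`. -/
def timeTangent (u : ℕ → ℝ → Params N → ℂ) (j : ℕ+) (a : Idx N) (x : Params N) (ε : ℝ)
    (c : ℂ) : PowerSeries ℂ :=
  mk fun m => fderiv ℝ (fun z : ℂ => u m ε (moveT j a z x)) 0 c

theorem moveT_zero (j : ℕ+) (a : Idx N) (x : Params N) : moveT j a 0 x = x := by
  simp [moveT]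

/-- Smoothness up to the boundary gives a derivative near the corner that is continuous at it.
Moving a time keeps `ε` fixed, so such curves stay in the half space even at `ε = 0` and yield
genuine derivatives there. -/
theorem SmoothAtZero.hasFDerivAt_time {x : Params N} {f : ℝ → Params N → ℂ}
    (h : SmoothAtZero x f) (j : ℕ+) (a : Idx N) :
    DifferentiableAt ℝ (fun z : ℂ => f 0 (moveT j a z x)) 0 ∧
    (∀ᶠ ε in 𝓝[>] (0 : ℝ), DifferentiableAt ℝ (fun z : ℂ => f ε (moveT j a z x)) 0) ∧
    ∀ c, Tendsto (fun ε => fderiv ℝ (fun z : ℂ => f ε (moveT j a z x)) 0 c) (𝓝[>] 0)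
      (𝓝 (fderiv ℝ (fun z : ℂ => f 0 (moveT j a z x)) 0 c)) := by
  have h1 := ((h.contDiffWithinAt_moved 0 j a).of_le (m := 0 + 1) (by simp))
  rw [contDiffWithinAt_succ_iff_hasFDerivWithinAt' (by simp)] at h1
  obtain ⟨s, hs, hs', -, f', hf', hc⟩ := h1
  have hins : insert ((0, 0) : ℝ × (ℝ × ℂ)) (Set.Ici 0 ×ˢ Set.univ) = Set.Ici 0 ×ˢ Set.univ := by
    simp
  rw [hins] at hs hs'
  have hmem : ∀ᶠ ε in 𝓝[≥] (0 : ℝ), ((ε, 0) : ℝ × (ℝ × ℂ)) ∈ s := by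
    have : Tendsto (fun ε : ℝ => ((ε, 0) : ℝ × (ℝ × ℂ))) (𝓝[≥] 0)
        (𝓝[Set.Ici 0 ×ˢ Set.univ] (0, 0)) := by
      refine tendsto_nhdsWithin_iff.2 ⟨?_, ?_⟩
      · exact ((by fun_prop : Continuous fun ε : ℝ => ((ε, 0) : ℝ × (ℝ × ℂ))).tendsto 0).mono_left
          nhdsWithin_le_nhds
      · filter_upwards [self_mem_nhdsWithin] with ε hε
        exact ⟨hε, trivial⟩
    exact this hs
  have hder : ∀ ε : ℝ, 0 ≤ ε → ((ε, 0) : ℝ × (ℝ × ℂ)) ∈ s →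
      HasFDerivAt (fun z : ℂ => f ε (moveT j a z x))
        ((f' (ε, 0)).comp ((0 : ℂ →L[ℝ] ℝ).prod ((0 : ℂ →L[ℝ] ℝ).prod (.id ℝ ℂ)))) 0 := by
    intro ε hε hm
    have hcv : HasFDerivWithinAt (fun z : ℂ => ((ε, (0, z)) : ℝ × (ℝ × ℂ)))
        ((0 : ℂ →L[ℝ] ℝ).prod ((0 : ℂ →L[ℝ] ℝ).prod (.id ℝ ℂ))) Set.univ 0 :=
      ((hasFDerivAt_const _ _).prodMk ((hasFDerivAt_const _ _).prodMk
        (hasFDerivAt_id _))).hasFDerivWithinAt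
    have := HasFDerivWithinAt.comp (0 : ℂ) (hf' _ hm) hcv (fun z _ => ⟨hε, trivial⟩)
    rw [hasFDerivWithinAt_univ] at this
    refine this.congr_of_eventuallyEq (Eventually.of_forall fun z => ?_)
    simp [moved, moveT]
  have h0 : ((0, 0) : ℝ × (ℝ × ℂ)) ∈ s := hmem.self_of_nhdsWithin Set.self_mem_Ici
  have hpos : ∀ᶠ ε in 𝓝[>] (0 : ℝ), 0 ≤ ε ∧ ((ε, 0) : ℝ × (ℝ × ℂ)) ∈ s := by
    filter_upwards [self_mem_nhdsWithin,
      nhdsWithin_mono _ Set.Ioi_subset_Ici_self hmem] with ε h1 h2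
    exact ⟨le_of_lt h1, h2⟩
  refine ⟨(hder 0 le_rfl h0).differentiableAt, ?_, fun c => ?_⟩
  · filter_upwards [hpos] with ε hε
    exact (hder ε hε.1 hε.2).differentiableAt
  · rw [(hder 0 le_rfl h0).fderiv]
    have hcont : Tendsto (fun ε : ℝ => f' (ε, 0)) (𝓝[>] 0) (𝓝 (f' (0, 0))) := by
      have h3 : ContinuousWithinAt f' (Set.Ici 0 ×ˢ Set.univ) (0, 0) := by
        have := hc.continuousWithinAt
        simpa [hins] using this
      refine h3.tendsto.comp (tendsto_nhdsWithin_iff.2 ⟨?_, ?_⟩)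
      · exact ((by fun_prop : Continuous fun ε : ℝ => ((ε, 0) : ℝ × (ℝ × ℂ))).tendsto 0).mono_left
          nhdsWithin_le_nhds
      · filter_upwards [self_mem_nhdsWithin] with ε hε
        exact ⟨Set.Ioi_subset_Ici_self hε, trivial⟩
    have h4 : Tendsto (fun ε : ℝ => f' (ε, 0) (0, (0, c))) (𝓝[>] 0) (𝓝 (f' (0, 0) (0, (0, c)))) :=
      ((ContinuousLinearMap.apply ℝ ℂ ((0, (0, c)) : ℝ × (ℝ × ℂ))).continuous.tendsto _).comp hcont
    refine (h4.congr' ?_)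
    filter_upwards [hpos] with ε hε
    rw [(hder ε hε.1 hε.2).fderiv]
    rfl

/-- The power series `exp (∑_i (u i / ε) w^i)`. -/
def wave (u : ℕ → ℝ → Params N → ℂ) (ε : ℝ) (x : Params N) : PowerSeries ℂ :=
  expSeries (mk fun i => u i ε x / ε)

theorem isUnit_wave (u : ℕ → ℝ → Params N → ℂ) (ε : ℝ) (x : Params N) : IsUnit (wave u ε x) :=
  isUnit_expSeries _

theorem hasDerivAt_coeff_wave {u : ℕ → ℝ → Params N → ℂ} {j : ℕ+} {a : Idx N} {x : Params N}
    {ε : ℝ} {M : ℕ}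
    (h : ∀ m ≤ M, DifferentiableAt ℝ (fun z : ℂ => u m ε (moveT j a z x)) 0) (c : ℂ) (m : ℕ)
    (hm : m ≤ M) :
    HasDerivAt (fun t : ℝ => coeff m (wave u ε (moveT j a (t * c) x)))
      (coeff m (wave u ε x * timeTangent u j a x ε c) / ε) 0 := by
  have hc : HasDerivAt (fun t : ℝ => (t : ℂ) * c) c 0 :=
    ((Complex.ofRealCLM.hasDerivAt (x := (0 : ℝ))).mul_const c).congr_deriv (by simp)
  have h1 : ∀ n ≤ M, HasDerivAt
      (fun t : ℝ => coeff n (mk fun i => u i ε (moveT j a (t * c) x) / ε))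
      (coeff n (C (ε : ℂ)⁻¹ * timeTangent u j a x ε c)) 0 := by
    intro n hn
    simp only [coeff_mk, coeff_C_mul, timeTangent]
    rw [mul_comm, ← div_eq_mul_inv]
    exact ((h n hn).hasFDerivAt.comp_hasDerivAt_of_eq (0 : ℝ) hc (by simp)).div_const _
  refine (hasDerivAt_coeff_expSeries h1 m hm).congr_deriv ?_
  simp only [Complex.ofReal_zero, zero_mul, moveT_zero, wave]
  rw [mul_left_comm, coeff_C_mul, mul_comm, div_eq_mul_inv]

/-- The phases are assumed smooth only in the real sense, while the hierarchy makes the wave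
coefficients complex differentiable. The derivative of the wave along `c` is the wave times the
tangent series divided by `ε`; as the wave is a unit, the Cauchy–Riemann equations pass to the
phases. -/
theorem timeTangent_I {u : ℕ → ℝ → Params N → ℂ} {j : ℕ+} {a : Idx N} {x : Params N}
    {ε : ℝ} (hε : ε ≠ 0) {M : ℕ}
    (h : ∀ m ≤ M, DifferentiableAt ℝ (fun z : ℂ => u m ε (moveT j a z x)) 0)
    (hd : ∀ m ≤ M, DifferentiableAt ℂ (fun z : ℂ => coeff m (wave u ε (moveT j a z x))) 0)
    (m : ℕ) (hm : m ≤ M) :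
    coeff m (timeTangent u j a x ε Complex.I) = Complex.I * coeff m (timeTangent u j a x ε 1) ∧
    HasDerivAt (fun z : ℂ => coeff m (wave u ε (moveT j a z x)))
      (coeff m (wave u ε x * timeTangent u j a x ε 1) / ε) 0 := by
  have hε' : (ε : ℂ) ≠ 0 := by exact_mod_cast hε
  have key : ∀ n ≤ M, ∀ c, coeff n (wave u ε x * timeTangent u j a x ε c) / ε
      = deriv (fun z : ℂ => coeff n (wave u ε (moveT j a z x))) 0 * c := by
    intro n hn c
    have hc : HasDerivAt (fun t : ℝ => (t : ℂ) * c) c 0 :=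
      ((Complex.ofRealCLM.hasDerivAt (x := (0 : ℝ))).mul_const c).congr_deriv (by simp)
    have h2 := HasDerivAt.comp_of_eq (0 : ℝ) (hd n hn).hasDerivAt hc (by simp)
    exact (hasDerivAt_coeff_wave h c n hn).unique h2
  constructor
  · have := coeff_eq_zero_of_isUnit_mul (isUnit_wave u ε x) (M := M)
      (f := timeTangent u j a x ε Complex.I - C Complex.I * timeTangent u j a x ε 1)
      (fun n hn => ?_) m hm
    · rw [map_sub, coeff_C_mul, sub_eq_zero] at this
      exact this
    · rw [mul_sub, mul_left_comm, map_sub, coeff_C_mul, sub_eq_zero]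
      have h1 := key n hn 1
      have h2 := key n hn Complex.I
      rw [div_eq_iff hε'] at h1 h2
      rw [h1, h2]
      ring
  · rw [key m hm 1, mul_one]
    exact (hd m hm).hasDerivAt

theorem tendsto_coeff_timeTangent {u : ℕ → ℝ → Params N → ℂ} {j : ℕ+} {a : Idx N} {x : Params N}
    (hs : ∀ m, SmoothAtZero x (u m)) (c : ℂ) (m : ℕ) :
    Tendsto (fun ε => coeff m (timeTangent u j a x ε c)) (𝓝[>] 0)
      (𝓝 (coeff m (timeTangent u j a x 0 c))) := by
  simpa only [timeTangent, coeff_mk] using ((hs m).hasFDerivAt_time j a).2.2 c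

theorem eventually_timeTangent {u : ℕ → ℝ → Params N → ℂ} {j : ℕ+} {a : Idx N} {x : Params N}
    (hs : ∀ m, SmoothAtZero x (u m))
    (hd : ∀ m, ∀ᶠ ε in 𝓝[>] (0 : ℝ),
      DifferentiableAt ℂ (fun z : ℂ => coeff m (wave u ε (moveT j a z x))) 0)
    (m : ℕ) : ∀ᶠ ε in 𝓝[>] (0 : ℝ),
    coeff m (timeTangent u j a x ε Complex.I) = Complex.I * coeff m (timeTangent u j a x ε 1) ∧
    HasDerivAt (fun z : ℂ => coeff m (wave u ε (moveT j a z x)))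
      (coeff m (wave u ε x * timeTangent u j a x ε 1) / ε) 0 := by
  have h1 : ∀ᶠ ε in 𝓝[>] (0 : ℝ), ∀ n ∈ Set.Iic m,
      DifferentiableAt ℝ (fun z : ℂ => u n ε (moveT j a z x)) 0 :=
    (eventually_all_finite (Set.finite_Iic m)).2 fun n _ => ((hs n).hasFDerivAt_time j a).2.1
  have h2 := (eventually_all_finite (Set.finite_Iic m)).2 fun n _ => hd n
  filter_upwards [h1, h2, self_mem_nhdsWithin] with ε h1 h2 hε
  exact timeTangent_I (ne_of_gt hε) h1 h2 m le_rfl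

/-- The Cauchy–Riemann equations, known for small `ε > 0`, survive the limit `ε → 0` because the
tangents are continuous there. -/
theorem hasDerivAt_time {u : ℕ → ℝ → Params N → ℂ} {j : ℕ+} {a : Idx N} {x : Params N}
    (hs : ∀ m, SmoothAtZero x (u m))
    (hd : ∀ m, ∀ᶠ ε in 𝓝[>] (0 : ℝ),
      DifferentiableAt ℂ (fun z : ℂ => coeff m (wave u ε (moveT j a z x))) 0)
    (m : ℕ) :
    HasDerivAt (fun z : ℂ => u m 0 (moveT j a z x)) (coeff m (timeTangent u j a x 0 1)) 0 := by
  rw [timeTangent, coeff_mk]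
  refine hasDerivAt_of_real ((hs m).hasFDerivAt_time j a).1.hasFDerivAt ?_
  have h1 := tendsto_coeff_timeTangent hs (j := j) (a := a) Complex.I m
  have h2 := (tendsto_coeff_timeTangent hs (j := j) (a := a) 1 m).const_mul Complex.I
  have := tendsto_nhds_unique (h1.congr' ((eventually_timeTangent hs hd m).mono fun ε h => h.1)) h2
  simpa only [timeTangent, coeff_mk] using this

/-! ### Banded operators -/

theorem IsBanded.mono {d e : ℕ} {X : Op N} (hX : IsBanded d X) (h : d ≤ e) : IsBanded e X :=
  fun i n hi => hX i n (by omega)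

theorem opMul_eq_sum {d : ℕ} {X : Op N} (hX : IsBanded d X) (Y : Op N) (m n : ℤ) :
    opMul X Y m n = ∑ i ∈ Finset.Icc (-(d : ℤ)) d, X i n * Y (m - i) (n + i) := by
  refine finsum_eq_sum_of_support_subset _ fun i hi => ?_
  rw [Finset.coe_Icc, Set.mem_Icc, ← abs_le]
  by_contra h
  exact hi (by simp only [hX i n (not_le.1 h), zero_mul])

theorem IsBanded.opMul {d e : ℕ} {X Y : Op N} (hX : IsBanded d X) (hY : IsBanded e Y) :
    IsBanded (d + e) (opMul X Y) := by
  intro m n hm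
  rw [opMul_eq_sum hX]
  refine Finset.sum_eq_zero fun i hi => ?_
  rw [Finset.mem_Icc, ← abs_le] at hi
  have := abs_sub_abs_le_abs_sub m i
  rw [hY (m - i) _ (by push_cast at hm; omega), mul_zero]

/-- Bandedness of the two left factors keeps every sum finite, so `Z` may be a full dressing
operator. -/
theorem opMul_assoc {d e : ℕ} {X Y : Op N} (hX : IsBanded d X) (hY : IsBanded e Y) (Z : Op N)
    (m n : ℤ) : opMul (opMul X Y) Z m n = opMul X (opMul Y Z) m n := by
  rw [opMul_eq_sum (hX.opMul hY), opMul_eq_sum hX]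
  simp only [opMul_eq_sum hX, Finset.sum_mul]
  rw [Finset.sum_comm]
  refine Finset.sum_congr rfl fun i hi => ?_
  rw [Finset.mem_Icc, ← abs_le] at hi
  simp only [mul_assoc]
  rw [← Finset.mul_sum]
  congr 1
  have h1 : ∑ p ∈ Finset.Icc (-((d + e : ℕ) : ℤ)) (d + e : ℕ),
      Y (p - i) (n + i) * Z (m - p) (n + p)
      = ∑ᶠ p : ℤ, Y (p - i) (n + i) * Z (m - p) (n + p) := by
    refine (finsum_eq_sum_of_support_subset _ fun p hp => ?_).symm
    rw [Finset.coe_Icc, Set.mem_Icc, ← abs_le]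
    by_contra h
    have := abs_sub_abs_le_abs_sub p i
    exact hp (by simp only [hY (p - i) _ (by push_cast at h; omega), zero_mul])
  rw [h1]
  refine Eq.trans ?_ (finsum_comp_equiv (Equiv.subRight i)
    (f := fun q => Y q (n + i) * Z (m - i - q) (n + i + q)))
  refine finsum_congr fun p => ?_
  simp only [Equiv.subRight_apply]
  congr 2 <;> ring

theorem opMul_sub_sum {d : ℕ} {ι : Type*} (s : Finset ι) (c : ι → ℂ) {X : Op N} {Y : ι → Op N}
    (hX : IsBanded d X) (hY : ∀ i ∈ s, IsBanded d (Y i)) (Z : Op N) (m n : ℤ) :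
    opMul (X - ∑ i ∈ s, c i • Y i) Z m n = opMul X Z m n - ∑ i ∈ s, c i • opMul (Y i) Z m n := by
  have hb : IsBanded d (X - ∑ i ∈ s, c i • Y i) := by
    intro p n hp
    simp only [Pi.sub_apply, Finset.sum_apply, Pi.smul_apply, hX p n hp, zero_sub, neg_eq_zero]
    exact Finset.sum_eq_zero fun i hi => by rw [hY i hi p n hp, smul_zero]
  rw [opMul_eq_sum hb, opMul_eq_sum hX]
  have h1 : ∑ i ∈ s, c i • opMul (Y i) Z m n
      = ∑ p ∈ Finset.Icc (-(d : ℤ)) d, ∑ i ∈ s, c i • (Y i p n * Z (m - p) (n + p)) := by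
    rw [Finset.sum_comm]
    exact Finset.sum_congr rfl fun i hi => by rw [opMul_eq_sum (hY i hi), Finset.smul_sum]
  rw [h1, ← Finset.sum_sub_distrib]
  refine Finset.sum_congr rfl fun p _ => ?_
  simp only [Pi.sub_apply, Finset.sum_apply, Pi.smul_apply, sub_mul, Finset.sum_mul, smul_mul_assoc]

theorem isBanded_sub_sum {d : ℕ} {ι : Type*} (s : Finset ι) (c : ι → ℂ) {X : Op N} {Y : ι → Op N}
    (hX : IsBanded d X) (hY : ∀ i ∈ s, IsBanded d (Y i)) :
    IsBanded d (X - ∑ i ∈ s, c i • Y i) := by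
  intro p n hp
  simp only [Pi.sub_apply, Finset.sum_apply, Pi.smul_apply, hX p n hp, zero_sub, neg_eq_zero]
  exact Finset.sum_eq_zero fun i hi => by rw [hY i hi p n hp, smul_zero]

theorem opMul_row_eq {d : ℕ} {A : Op N} (hA : IsBanded d A) (Z : Op N) (m n : ℤ) (r : Fin N)
    {i : ℤ} (hi : |i| ≤ d) (h : ∀ p, p ≠ i → A p n r = 0 ∨ Z (m - p) (n + p) = 0) :
    opMul A Z m n r = Matrix.vecMul (A i n r) (Z (m - i) (n + i)) := by
  have h1 : opMul A Z m n r
      = ∑ p ∈ Finset.Icc (-(d : ℤ)) d, Matrix.vecMul (A p n r) (Z (m - p) (n + p)) := by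
    rw [opMul_eq_sum hA]
    refine (Finset.sum_apply r _ _).trans ?_
    exact Finset.sum_congr rfl fun p _ => Matrix.mul_apply_eq_vecMul _ _ _
  rw [h1, Finset.sum_eq_single_of_mem i (Finset.mem_Icc.2 (abs_le.1 hi))]
  intro p _ hp
  rcases h p hp with h | h
  · rw [h, Matrix.zero_vecMul]
  · rw [h, Matrix.vecMul_zero]

/-- A row of a banded operator `A` vanishes if that row of `A S` has only negative and that row of
`A Sbar` only nonnegative powers of `Λ`. -/
theorem row_eq_zero {d : ℕ} {A S Sbar : Op N} (hA : IsBanded d A) (hS : InGMinus S)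
    (hSbar : InGPlus Sbar) (n : ℤ) (r : Fin N)
    (h1 : ∀ m : ℤ, 0 ≤ m → m ≤ d → opMul A S m n r = 0)
    (h2 : ∀ m : ℤ, -(d : ℤ) ≤ m → m < 0 → opMul A Sbar m n r = 0) (i : ℤ) :
    A i n r = 0 := by
  have hband : ∀ i, (d : ℤ) < |i| → A i n r = 0 := fun i hi => by rw [hA i n hi]; rfl
  -- Descent from the top degree `d`: once all higher coefficients vanish, the coefficient of `Λ^i`
  -- in `A S` is that of `A`, since `S` has leading term `1`.
  have hpos : ∀ t : ℕ, ∀ i : ℤ, 0 ≤ i → (d : ℤ) < i + t → A i n r = 0 := by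
    intro t
    induction t with
    | zero => exact fun i hi hd => hband i (by rw [abs_of_nonneg hi]; simpa using hd)
    | succ t ih =>
      intro i hi hd
      by_cases hid : (d : ℤ) < i
      · exact ih i hi (by omega)
      have := h1 i hi (by omega)
      rw [opMul_row_eq hA S i n r (i := i) (by rw [abs_of_nonneg hi]; omega)] at this
      · rwa [sub_self, hS.1, Matrix.vecMul_one] at this
      · intro p hp
        rcases lt_or_gt_of_ne hp with h | h
        · exact Or.inr (hS.2 _ _ (by omega))
        · exact Or.inl (ih p (by omega) (by push_cast at hd; omega))
  -- Ascent from the bottom degree `-d`, where the lowest surviving coefficient is multiplied by the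
  -- invertible `Sbar 0`.
  have hneg : ∀ t : ℕ, ∀ i : ℤ, i < 0 → i < t - (d : ℤ) → A i n r = 0 := by
    intro t
    induction t with
    | zero => exact fun i hi hd => hband i (by rw [abs_of_neg hi]; push_cast at hd; omega)
    | succ t ih =>
      intro i hi hd
      by_cases hid : i < -(d : ℤ)
      · exact ih i hi (by omega)
      have := h2 i (by omega) hi
      rw [opMul_row_eq hA Sbar i n r (i := i) (by rw [abs_of_neg hi]; omega)] at this
      · rw [sub_self] at this
        have hu := hSbar.1 (n + i)
        have h3 := congrArg (fun v => Matrix.vecMul v (Sbar 0 (n + i))⁻¹) this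
        simp only [Matrix.vecMul_vecMul, Matrix.zero_vecMul] at h3
        rwa [Matrix.mul_nonsing_inv _ ((Matrix.isUnit_iff_isUnit_det _).1 hu),
          Matrix.vecMul_one] at h3
      · intro p hp
        rcases lt_or_gt_of_ne hp with h | h
        · exact Or.inl (ih p (by omega) (by push_cast at hd; omega))
        · exact Or.inr (hSbar.2 _ _ (by omega))
  rcases lt_or_ge i 0 with h | h
  · exact hneg (d + 1) i h (by push_cast; omega)
  · exact hpos (d + 1) i h (by push_cast; omega)

/-! ### The first row -/

/-- The coefficient of `w^m` in the series `rowSeries X Y n b`, for all integers `m`. -/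
def rowCoeff [NeZero N] (X Y : Op N) (n : ℤ) (b : Idx N) (m : ℤ) : ℂ :=
  match b with
  | Sum.inl k => X (-(m + if k = 0 then 0 else 1)) n 0 k
  | Sum.inr k => Y m n 0 k

/-- The lowest power of `w` which is left free by the normalization at the puncture `b`. -/
def lowest [NeZero N] (b : Idx N) : ℤ := if b = one then 1 else 0

/-- The exponent of `w` in the vacuum factor of the shift `T_{(a,c)}` at the puncture `b`. -/
def shiftExp (a c b : Idx N) : ℤ := (if b = c then 1 else 0) - (if b = a then 1 else 0)

theorem rowCoeff_natCast [NeZero N] (X Y : Op N) (n : ℤ) (b : Idx N) (m : ℕ) :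
    rowCoeff X Y n b m = PowerSeries.coeff m (rowSeries X Y n b) := by
  cases b <;> simp [rowCoeff, rowSeries]

theorem rowCoeff_of_neg [NeZero N] {X Y : Op N} (hX : InGMinus X) (hY : InGPlus Y) (n : ℤ)
    (b : Idx N) {m : ℤ} (hm : m < 0) : rowCoeff X Y n b m = 0 := by
  rcases b with k | k
  · by_cases hk : k = 0
    · simp only [rowCoeff, hk, if_true]
      rw [hX.2 _ _ (by omega)]
      rfl
    · simp only [rowCoeff, hk, if_false]
      rcases eq_or_lt_of_le (Int.add_one_le_iff.2 hm) with h | h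
      · rw [h, neg_zero, hX.1, Matrix.one_apply_ne (Ne.symm hk)]
      · rw [hX.2 _ _ (by omega)]
        rfl
  · simp only [rowCoeff]
    rw [hY.2 _ _ hm]
    rfl

/-- Powers of `w` below `lowest b` are exactly the powers of `Λ` excluded in `row_eq_zero`. The
bound `d + 1` instead of `d` accounts for the extra `w⁻¹` in the unbarred columns other than the
first. -/
theorem rowCoeff_opMul_eq_zero [NeZero N] {d : ℕ} {A S Sbar : Op N} (hA : IsBanded d A)
    (hS : InGMinus S) (hSbar : InGPlus Sbar) (n : ℤ)
    (h : ∀ b m, -((d : ℤ) + 1) ≤ m → m < lowest b →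
      rowCoeff (opMul A S) (opMul A Sbar) n b m = 0) (b : Idx N) (m : ℤ) :
    rowCoeff (opMul A S) (opMul A Sbar) n b m = 0 := by
  have hrow : ∀ i, A i n 0 = 0 := by
    refine row_eq_zero hA hS hSbar n 0 (fun m h0 hd => ?_) (fun m h0 hd => ?_)
    · ext k
      by_cases hk : k = 0
      · have := h (Sum.inl k) (-m) (by omega) (by simp [lowest, one, hk]; omega)
        simpa [rowCoeff, hk] using this
      · have := h (Sum.inl k) (-m - 1) (by omega) (by simp [lowest, one, hk]; omega)
        simpa [rowCoeff, hk] using this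
    · ext k
      exact h (Sum.inr k) m (by omega) (by simpa [lowest, one] using hd)
  have hmul : ∀ (Z : Op N) m k, opMul A Z m n 0 k = 0 := by
    intro Z m k
    rw [opMul_row_eq hA Z m n 0 (i := 0) (by simp) fun p _ => Or.inl (hrow p), hrow,
      Matrix.zero_vecMul]
    rfl
  cases b <;> exact hmul _ _ _

theorem rowCoeff_opMul_sub_sum [NeZero N] {d : ℕ} {ι : Type*} (s : Finset ι) (c : ι → ℂ)
    {X : Op N} {Y : ι → Op N} (hX : IsBanded d X) (hY : ∀ i ∈ s, IsBanded d (Y i))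
    (S Sbar : Op N) (n : ℤ) (b : Idx N) (m : ℤ) :
    rowCoeff (opMul (X - ∑ i ∈ s, c i • Y i) S) (opMul (X - ∑ i ∈ s, c i • Y i) Sbar) n b m
      = rowCoeff (opMul X S) (opMul X Sbar) n b m
        - ∑ i ∈ s, c i * rowCoeff (opMul (Y i) S) (opMul (Y i) Sbar) n b m := by
  cases b <;> simp [rowCoeff, opMul_sub_sum s c hX hY, Matrix.sum_apply]

/-! ### Vacuum factors -/

theorem opMul_diagShift (X : Op N) (k : Fin N) (j m n : ℤ) :
    opMul X (diagShift k j) m n = X (m - j) n * Matrix.single k k 1 := by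
  rw [opMul, finsum_eq_single _ (m - j)]
  · simp [diagShift]
  · intro i hi
    rw [diagShift, if_neg (by omega), mul_zero]

/-- A diagonal vacuum factor on the right shifts the degree in each column separately; for this
reason the iterated shifts below are stated entrywise. -/
theorem opMul_sum_diagShift_apply (X : Op N) (e : Fin N → ℤ) (m n : ℤ) (l k : Fin N) :
    opMul X (∑ q, diagShift q (e q)) m n l k = X (m - e k) n l k := by
  have h : opMul X (∑ q, diagShift q (e q)) m n
      = ∑ q, X (m - e q) n * Matrix.single q q 1 := by
    simp only [opMul, Finset.sum_apply, Finset.mul_sum]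
    rw [finsum_sum_comm]
    · exact Finset.sum_congr rfl fun q _ => opMul_diagShift X q (e q) m n
    · intro q _
      refine (Set.finite_singleton (m - e q)).subset fun i hi => ?_
      by_contra h
      refine hi ?_
      have h' : m - i ≠ e q := fun h' => h (Set.mem_singleton_iff.2 (by omega))
      simp only [diagShift, if_neg h', mul_zero]
  rw [h, Matrix.sum_apply, Finset.sum_eq_single k]
  · simp
  · intro q _ hq
    simp [Matrix.mul_apply, hq]
  · simp

theorem rowCoeff_vacFlow [NeZero N] (S Sbar : Op N) (j : ℕ+) (a b : Idx N) (n m : ℤ) :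
    rowCoeff (opMul S (vacFlow j a)) (opMul Sbar (vacFlowBar j a)) n b m
      = if a = b then rowCoeff S Sbar n b (m + (j : ℕ)) else 0 := by
  have h0 : ∀ X : Op N, opMul X 0 = 0 := fun X => by
    funext m n
    simp [opMul]
  have hs : ∀ (X : Op N) (k k' : Fin N) (j m : ℤ), opMul X (diagShift k j) m n 0 k'
      = if k = k' then X (m - j) n 0 k' else 0 := by
    intro X k k' j m
    rw [opMul_diagShift, Matrix.mul_apply]
    simp only [Matrix.single_apply]
    by_cases h : k = k'
    · subst h; simp
    · simp [h]
  rcases a with k | k <;> rcases b with k' | k' <;>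
    simp only [rowCoeff, vacFlow, vacFlowBar, h0, hs, Sum.inl.injEq, Sum.inr.injEq, reduceCtorEq,
      if_false, Pi.zero_apply, Matrix.zero_apply]
  · congr 2; ring
  · rw [sub_neg_eq_add]

/-! ### Iterated shifts -/

/-- The point obtained by moving the charges `i` times by `ε` along `v`. -/
def linePoint (v : ZeroCharge N) (x : Params N) (i : ℕ) (ε : ℝ) : Params N :=
  (x.1 + ((i : ℝ) * ε) • v, x.2)

theorem moveS_linePoint (a c : Idx N) (x : Params N) (i : ℕ) (ε : ℝ) :
    moveS a c ε (linePoint (dir a c) x i ε) = linePoint (dir a c) x (i + 1) ε := by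
  refine Prod.ext ?_ rfl
  simp only [moveS, linePoint]
  push_cast
  rw [add_mul, one_mul, add_smul, add_assoc]

theorem linePoint_zero (v : ZeroCharge N) (x : Params N) (ε : ℝ) : linePoint v x 0 ε = x := by
  simp [linePoint]

variable {n₀ : ℝ → ℤ} {U : Set (Params N)} {S Sbar : ℝ → Params N → Op N}

/-- The operator `A` is the product of the elementary shift operators at the successive points of
the line. It is applied to the fixed `S ε x`, so that all powers of the shift can be compared with
the flow at one point. -/
theorem IsTodaSolution.exists_iterate (h : IsTodaSolution n₀ U S Sbar) {x : Params N}
    (hx : x ∈ U) {a c : Idx N} (hac : a ≠ c) (i : ℕ) :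
    ∃ A : ℝ → Op N, (∀ ε, IsBanded i (A ε)) ∧ ∀ m n : ℤ, ∀ᶠ ε in 𝓝[>] (0 : ℝ), ∀ l k,
      opMul (A ε) (S ε x) m (n₀ ε + n) l k
        = S ε (linePoint (dir a c) x i ε)
            (m - i * ((if a = Sum.inl k then 1 else 0) - (if c = Sum.inl k then 1 else 0)))
            (n₀ ε + n) l k ∧
      opMul (A ε) (Sbar ε x) m (n₀ ε + n) l k
        = Sbar ε (linePoint (dir a c) x i ε)
            (m - i * ((if c = Sum.inr k then 1 else 0) - (if a = Sum.inr k then 1 else 0)))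
            (n₀ ε + n) l k := by
  induction i with
  | zero =>
    have hb : IsBanded 0 (fun i _ => if i = 0 then 1 else 0 : Op N) := by
      intro i n hi
      refine if_neg ?_
      rintro rfl
      simp at hi
    refine ⟨fun _ => fun i _ => if i = 0 then 1 else 0, fun _ => hb, fun m n => ?_⟩
    refine Eventually.of_forall fun ε l k => ?_
    simp [opMul_eq_sum hb, linePoint_zero]
  | succ i ih =>
    obtain ⟨A, hA, hAS⟩ := ih
    obtain ⟨T, hT, hTS⟩ := h.disc a c hac
    refine ⟨fun ε => opMul (T ε (linePoint (dir a c) x i ε)) (A ε), fun ε => ?_, fun m n => ?_⟩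
    · rw [add_comm i 1]
      exact (hT _ _).opMul (hA ε)
    -- The band of `T` reaches the rows `n - 1`, `n` and `n + 1`; hence the induction has to run
    -- over all rows.
    have h1 : ∀ᶠ ε in 𝓝[>] (0 : ℝ), ∀ q ∈ Finset.Icc (-1 : ℤ) 1, ∀ l k,
        opMul (A ε) (S ε x) (m - q) (n₀ ε + (n + q)) l k
          = S ε (linePoint (dir a c) x i ε)
              (m - q - i * ((if a = Sum.inl k then 1 else 0) - (if c = Sum.inl k then 1 else 0)))
              (n₀ ε + (n + q)) l k ∧
        opMul (A ε) (Sbar ε x) (m - q) (n₀ ε + (n + q)) l k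
          = Sbar ε (linePoint (dir a c) x i ε)
              (m - q - i * ((if c = Sum.inr k then 1 else 0) - (if a = Sum.inr k then 1 else 0)))
              (n₀ ε + (n + q)) l k :=
      (eventually_all_finset _).2 fun q _ => hAS (m - q) (n + q)
    have h2 := fun m => (hTS x hx m n).eventually_line (dir a c) a i
    have h3 : ∀ᶠ ε in 𝓝[>] (0 : ℝ), ∀ k, _ := eventually_all.2 fun k : Fin N =>
      (h2 (m - i * ((if a = Sum.inl k then 1 else 0) - (if c = Sum.inl k then 1 else 0)))).and
      (h2 (m - i * ((if c = Sum.inr k then 1 else 0) - (if a = Sum.inr k then 1 else 0))))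
    filter_upwards [h1, h3] with ε h1 h3 l k
    have key : ∀ (Z Z' : Op N) (e : ℤ) (he : ∀ q ∈ Finset.Icc (-1 : ℤ) 1, ∀ l,
        opMul (A ε) Z (m - q) (n₀ ε + (n + q)) l k = Z' (m - q - e) (n₀ ε + (n + q)) l k),
        opMul (opMul (T ε (linePoint (dir a c) x i ε)) (A ε)) Z m (n₀ ε + n) l k
          = opMul (T ε (linePoint (dir a c) x i ε)) Z' (m - e) (n₀ ε + n) l k := by
      intro Z Z' e he
      rw [opMul_assoc (hT _ _) (hA ε), opMul_eq_sum (hT _ _), opMul_eq_sum (hT _ _),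
        Matrix.sum_apply, Matrix.sum_apply]
      refine Finset.sum_congr rfl fun q hq => ?_
      rw [Matrix.mul_apply, Matrix.mul_apply]
      refine Finset.sum_congr rfl fun l' _ => ?_
      rw [add_assoc, he q hq, sub_right_comm]
    constructor
    · rw [key _ _ _ fun q hq l => (h1 q hq l k).1]
      have := congrFun (congrFun (h3 k).1.1 l) k
      change opMul (S ε (moveS a c ε (linePoint (dir a c) x i ε))) _ _ _ l k = _ at this
      refine this.symm.trans ?_
      rw [vacShift, opMul_sum_diagShift_apply, moveS_linePoint]
      have : ∀ e : ℤ, m - i * e - e = m - ((i + 1 : ℕ) : ℤ) * e := fun e => by push_cast; ring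
      rw [this]
    · rw [key _ _ _ fun q hq l => (h1 q hq l k).2]
      have := congrFun (congrFun (h3 k).2.2 l) k
      change opMul (Sbar ε (moveS a c ε (linePoint (dir a c) x i ε))) _ _ _ l k = _ at this
      refine this.symm.trans ?_
      rw [vacShiftBar, opMul_sum_diagShift_apply, moveS_linePoint]
      have : ∀ e : ℤ, m - i * e - e = m - ((i + 1 : ℕ) : ℤ) * e := fun e => by push_cast; ring
      rw [this]

theorem IsTodaSolution.exists_iterate_rowCoeff [NeZero N] (h : IsTodaSolution n₀ U S Sbar)
    {x : Params N} (hx : x ∈ U) {a c : Idx N} (hac : a ≠ c) (i : ℕ) :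
    ∃ A : ℝ → Op N, (∀ ε, IsBanded i (A ε)) ∧ ∀ b m, ∀ᶠ ε in 𝓝[>] (0 : ℝ),
      rowCoeff (opMul (A ε) (S ε x)) (opMul (A ε) (Sbar ε x)) (n₀ ε) b m
        = rowCoeff (S ε (linePoint (dir a c) x i ε)) (Sbar ε (linePoint (dir a c) x i ε)) (n₀ ε) b
            (m - i * shiftExp a c b) := by
  obtain ⟨A, hA, hAS⟩ := h.exists_iterate hx hac i
  refine ⟨A, hA, fun b m => ?_⟩
  rcases b with k | k
  · filter_upwards [hAS (-(m + if k = 0 then 0 else 1)) 0] with ε hε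
    have := (hε 0 k).1
    rw [add_zero] at this
    refine this.trans ?_
    simp only [rowCoeff, shiftExp, eq_comm (a := a), eq_comm (a := c)]
    congr 2
    ring
  · filter_upwards [hAS m 0] with ε hε
    have := (hε 0 k).2
    rw [add_zero] at this
    refine this.trans ?_
    simp only [rowCoeff, shiftExp, eq_comm (a := a), eq_comm (a := c)]

theorem IsTodaSolution.exists_flow_rowCoeff [NeZero N] (h : IsTodaSolution n₀ U S Sbar)
    {x : Params N} (hx : x ∈ U) (j : ℕ+) (a : Idx N) :
    ∃ B : ℝ → Op N, (∀ ε, IsBanded j (B ε)) ∧ ∀ b m, ∀ᶠ ε in 𝓝[>] (0 : ℝ),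
      HasDerivAt (fun z : ℂ => rowCoeff (S ε (moveT j a z x)) (Sbar ε (moveT j a z x)) (n₀ ε) b m)
        ((ε : ℂ)⁻¹ * (rowCoeff (opMul (B ε) (S ε x)) (opMul (B ε) (Sbar ε x)) (n₀ ε) b m
          - if a = b then rowCoeff (S ε x) (Sbar ε x) (n₀ ε) b (m + (j : ℕ)) else 0)) 0 := by
  obtain ⟨B, hB, hBS⟩ := h.flow j a
  refine ⟨fun ε => B ε x, fun ε => hB ε x, fun b m => ?_⟩
  rcases b with k | k
  · filter_upwards [(hBS x hx (-(m + if k = 0 then 0 else 1)) 0).eventually_self a] with ε hε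
    have := (hε 0 k).1
    rw [← rowCoeff_vacFlow]
    rw [add_zero] at this
    exact this
  · filter_upwards [(hBS x hx m 0).eventually_self a] with ε hε
    have := (hε 0 k).2
    rw [← rowCoeff_vacFlow]
    rw [add_zero] at this
    exact this

/-! ### Difference quotients of the phases along the charges -/

/-- The series of the derivatives of `u 0, u 1, …` at `ε = 0` along the charge direction `v`. -/
def chargeTangent (u : ℕ → ℝ → Params N → ℂ) (v : ZeroCharge N) (x : Params N) : PowerSeries ℂ :=
  mk fun m => deriv (fun s : ℝ => u m 0 (x.1 + s • v, x.2)) 0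

/-- The series of the difference quotients of `u 0, u 1, …` for `i` steps of size `ε` along `v`. -/
def chargeQuotient (u : ℕ → ℝ → Params N → ℂ) (v : ZeroCharge N) (x : Params N) (i : ℕ) (ε : ℝ) :
    PowerSeries ℂ :=
  mk fun m => (u m ε (linePoint v x i ε) - u m ε x) / ε

theorem hasDerivAt_chargeTangent {u : ℕ → ℝ → Params N → ℂ} {x : Params N} {m : ℕ}
    (hs : SmoothAtZero x (u m)) (v : ZeroCharge N) (a : Idx N) :
    HasDerivAt (fun s : ℝ => u m 0 (x.1 + s • v, x.2)) (coeff m (chargeTangent u v x)) 0 := by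
  obtain ⟨d, hd, -⟩ := hs.exists_hasDerivAt_line v a
  rw [chargeTangent, coeff_mk, hd.deriv]
  exact hd

theorem tendsto_coeff_chargeQuotient {u : ℕ → ℝ → Params N → ℂ} {x : Params N} {m : ℕ}
    (hs : SmoothAtZero x (u m)) (v : ZeroCharge N) (a : Idx N) (i : ℕ) :
    Tendsto (fun ε => coeff m (chargeQuotient u v x i ε)) (𝓝[>] 0)
      (𝓝 (coeff m (i • chargeTangent u v x))) := by
  obtain ⟨d, hd, ht⟩ := hs.exists_hasDerivAt_line v a
  have h := ht i
  simp only [chargeQuotient, coeff_mk, linePoint]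
  rw [map_nsmul, chargeTangent, coeff_mk, hd.deriv, nsmul_eq_mul]
  exact h

/-- A step of size `ε` in the charges changes the phase by `ε` times a difference quotient, which
cancels the `1/ε` in the exponent. -/
theorem wave_linePoint (u : ℕ → ℝ → Params N → ℂ) (v : ZeroCharge N) (x : Params N) (i : ℕ)
    (ε : ℝ) : wave u ε (linePoint v x i ε) = expSeries (chargeQuotient u v x i ε) * wave u ε x := by
  rw [wave, wave, ← expSeries_add]
  congr 1
  ext m
  simp only [chargeQuotient, map_add, coeff_mk]
  ring

/-! ### Expansion of the flows in powers of a shift -/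

/-- The coefficients in the expansion of the flow `t_{ja}` in powers of the shift `T_{(a,c)}`. -/
def flowCoeff (u : ℕ → ℝ → Params N → ℂ) (v : ZeroCharge N) (x : Params N) (j : ℕ) (ε : ℝ)
    (i : ℕ) : ℂ :=
  triangularSolution (fun k => expSeries (chargeQuotient u v x (j - k) ε))
    (fun m => if m = 0 then 1 else 0) (j - i)

/-- The difference between the flow `t_{ja}` and its expansion in powers of `T_{(a,c)}`, at the
puncture `b` and divided by the wave function. -/
def flowDefect (u : Idx N → ℕ → ℝ → Params N → ℂ) (x : Params N) (j : ℕ+) (a c b : Idx N)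
    (lo : ℕ) (ε : ℝ) : ℂ⸨X⸩ :=
  (timeTangent (u b) j a x ε 1 : ℂ⸨X⸩)
    + (if a = b then HahnSeries.single (-((j : ℕ) : ℤ)) 1 else 0)
    - ∑ i ∈ Finset.Icc lo (j : ℕ), HahnSeries.C (flowCoeff (u a) (dir a c) x j ε i) *
        (HahnSeries.single (i * shiftExp a c b) 1 *
          (expSeries (chargeQuotient (u b) (dir a c) x i ε) : ℂ⸨X⸩))

theorem coeff_flowDefect (u : Idx N → ℕ → ℝ → Params N → ℂ) (x : Params N) (j : ℕ+)
    (a c b : Idx N) (lo : ℕ) (ε : ℝ) (m : ℤ) :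
    (flowDefect u x j a c b lo ε).coeff m
      = (timeTangent (u b) j a x ε 1 : ℂ⸨X⸩).coeff m
        + (if a = b then if m = -((j : ℕ) : ℤ) then 1 else 0 else 0)
        - ∑ i ∈ Finset.Icc lo (j : ℕ), flowCoeff (u a) (dir a c) x j ε i *
            (expSeries (chargeQuotient (u b) (dir a c) x i ε) : ℂ⸨X⸩).coeff
              (m - i * shiftExp a c b) := by
  rw [flowDefect, HahnSeries.coeff_sub, HahnSeries.coeff_add, HahnSeries.coeff_sum]
  congr 1
  · congr 1
    split_ifs with h1 h2
    · rw [h2, HahnSeries.coeff_single_same]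
    · rw [HahnSeries.coeff_single_of_ne h2]
    · rfl
  · refine Finset.sum_congr rfl fun i _ => ?_
    rw [HahnSeries.C_mul_eq_smul, HahnSeries.coeff_smul, smul_eq_mul, coeff_single_one_mul]

/-- At its own puncture the `i`-th power of the shift starts with `w^{-i}`, so matching the powers
from `w^{-j}` upwards determines the coefficients one after another, beginning with `i = j`. -/
theorem sum_flowCoeff (u : ℕ → ℝ → Params N → ℂ) (v : ZeroCharge N) (x : Params N)
    (j lo : ℕ) (ε : ℝ) {q : ℕ} (hlo : lo ≤ q) :
    ∑ i ∈ Finset.Icc lo j, flowCoeff u v x j ε i *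
      (expSeries (chargeQuotient u v x i ε) : ℂ⸨X⸩).coeff ((i : ℤ) - q) = if q = j then 1 else 0 := by
  have hz : ∀ i ∈ Finset.Icc lo j, i ∉ Finset.Icc q j → flowCoeff u v x j ε i *
      (expSeries (chargeQuotient u v x i ε) : ℂ⸨X⸩).coeff ((i : ℤ) - q) = 0 := by
    intro i hi hi'
    rw [Finset.mem_Icc] at hi hi'
    rw [coeff_coe_of_neg _ (by omega), mul_zero]
  rw [← Finset.sum_subset (Finset.Icc_subset_Icc_left hlo) hz]
  rcases lt_or_ge j q with h | h
  · rw [Finset.Icc_eq_empty (by omega), Finset.sum_empty, if_neg (by omega)]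
  · have := sum_triangularSolution (fun k => expSeries (chargeQuotient u v x (j - k) ε))
      (fun m => if m = 0 then 1 else 0) (j - q) (by
        rw [constantCoeff_expSeries]; exact Complex.exp_ne_zero _)
    have e : (if q = j then (1 : ℂ) else 0) = if j - q = 0 then 1 else 0 := by
      congr 1
      exact propext (by omega)
    rw [e, ← this]
    -- The triangular system is indexed by `k = j - i`, the distance from the leading power.
    refine Finset.sum_nbij' (fun i => j - i) (fun k => j - k) ?_ ?_ ?_ ?_ ?_
    · intro i hi; rw [Finset.mem_Icc] at hi; rw [Finset.mem_range]; omega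
    · intro i hi; rw [Finset.mem_range] at hi; rw [Finset.mem_Icc]; omega
    · intro i hi; rw [Finset.mem_Icc] at hi; omega
    · intro i hi; rw [Finset.mem_range] at hi; omega
    · intro i hi
      rw [Finset.mem_Icc] at hi
      have h1 : (i : ℤ) - q = ((j - q - (j - i) : ℕ) : ℤ) := by omega
      have h2 : j - (j - i) = i := by omega
      rw [flowCoeff, h1, coeff_coe_natCast, h2]

theorem coeff_flowDefect_mul_wave (u : Idx N → ℕ → ℝ → Params N → ℂ) (x : Params N) (j : ℕ+)
    (a c b : Idx N) (lo : ℕ) (ε : ℝ) (m : ℤ) :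
    (flowDefect u x j a c b lo ε * (wave (u b) ε x : ℂ⸨X⸩)).coeff m
      = ((wave (u b) ε x * timeTangent (u b) j a x ε 1 : PowerSeries ℂ) : ℂ⸨X⸩).coeff m
          + (if a = b then (wave (u b) ε x : ℂ⸨X⸩).coeff (m + (j : ℕ)) else 0)
        - ∑ i ∈ Finset.Icc lo (j : ℕ), flowCoeff (u a) (dir a c) x j ε i *
            (wave (u b) ε (linePoint (dir a c) x i ε) : ℂ⸨X⸩).coeff (m - i * shiftExp a c b) := by
  rw [flowDefect, sub_mul, add_mul, Finset.sum_mul, HahnSeries.coeff_sub, HahnSeries.coeff_add,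
    HahnSeries.coeff_sum]
  congr 1
  · congr 1
    · rw [PowerSeries.coe_mul, mul_comm]
    · split_ifs
      · rw [coeff_single_one_mul, sub_neg_eq_add]
      · rw [zero_mul, HahnSeries.coeff_zero]
  · refine Finset.sum_congr rfl fun i _ => ?_
    rw [mul_assoc, mul_assoc, HahnSeries.C_mul_eq_smul, HahnSeries.coeff_smul, smul_eq_mul,
      coeff_single_one_mul, ← PowerSeries.coe_mul, wave_linePoint]

theorem tendsto_coeff_coe {ι : Type*} {l : Filter ι} {F : ι → PowerSeries ℂ}
    {f : PowerSeries ℂ} (h : ∀ n, Tendsto (fun i => coeff n (F i)) l (𝓝 (coeff n f))) (m : ℤ) :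
    Tendsto (fun i => (F i : ℂ⸨X⸩).coeff m) l (𝓝 ((f : ℂ⸨X⸩).coeff m)) := by
  rcases lt_or_ge m 0 with hm | hm
  · simp only [coeff_coe_of_neg _ hm]
    exact tendsto_const_nhds
  · lift m to ℕ using hm
    simpa only [coeff_coe_natCast] using h m

/-! ### The row coefficients in terms of the phases -/

section Rows

variable [NeZero N] {u : Idx N → ℕ → ℝ → Params N → ℂ}

theorem eventually_rowCoeff_line (hToda : IsTodaSolution n₀ U S Sbar)
    (hQC : IsQuasiClassical n₀ U S Sbar u) {x : Params N} (hx : x ∈ U) (v : ZeroCharge N)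
    (i : ℕ) (b : Idx N) (m : ℤ) : ∀ᶠ ε in 𝓝[>] (0 : ℝ),
      rowCoeff (S ε (linePoint v x i ε)) (Sbar ε (linePoint v x i ε)) (n₀ ε) b m
        = (wave (u b) ε (linePoint v x i ε) : ℂ⸨X⸩).coeff m := by
  rcases lt_or_ge m 0 with hm | hm
  · refine Eventually.of_forall fun ε => ?_
    rw [rowCoeff_of_neg (hToda.minus _ _) (hToda.plus _ _) _ _ hm, coeff_coe_of_neg _ hm]
  · lift m to ℕ using hm
    filter_upwards [(hQC.ansatz x hx b m).eventually_line v b i] with ε hε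
    rw [rowCoeff_natCast, coeff_coe_natCast]
    exact hε

theorem eventually_rowCoeff_time
    (hQC : IsQuasiClassical n₀ U S Sbar u) {x : Params N} (hx : x ∈ U) (j : ℕ+) (a b : Idx N)
    (m : ℕ) : ∀ᶠ ε in 𝓝[>] (0 : ℝ), ∀ᶠ z in 𝓝 (0 : ℂ),
      rowCoeff (S ε (moveT j a z x)) (Sbar ε (moveT j a z x)) (n₀ ε) b m
        = coeff m (wave (u b) ε (moveT j a z x)) := by
  filter_upwards [(hQC.ansatz x hx b m).eventually_time j a] with ε hε
  filter_upwards [hε] with z hz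
  rw [rowCoeff_natCast]
  exact hz

theorem eventually_differentiableAt_wave (hToda : IsTodaSolution n₀ U S Sbar)
    (hQC : IsQuasiClassical n₀ U S Sbar u) {x : Params N} (hx : x ∈ U) (j : ℕ+) (a b : Idx N)
    (m : ℕ) : ∀ᶠ ε in 𝓝[>] (0 : ℝ),
      DifferentiableAt ℂ (fun z : ℂ => coeff m (wave (u b) ε (moveT j a z x))) 0 := by
  obtain ⟨B, -, hB⟩ := hToda.exists_flow_rowCoeff hx j a
  filter_upwards [hB b m, eventually_rowCoeff_time hQC hx j a b m] with ε h1 h2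
  exact h1.differentiableAt.congr_of_eventuallyEq (h2.mono fun z hz => hz.symm)

/-- The derivative of a wave coefficient is computed from the hierarchy and from the ansatz; both
carry the factor `1/ε`, which cancels. -/
theorem exists_flow_wave (hToda : IsTodaSolution n₀ U S Sbar)
    (hQC : IsQuasiClassical n₀ U S Sbar u) {x : Params N} (hx : x ∈ U) (j : ℕ+) (a : Idx N) :
    ∃ B : ℝ → Op N, (∀ ε, IsBanded j (B ε)) ∧ ∀ b m, ∀ᶠ ε in 𝓝[>] (0 : ℝ),
      rowCoeff (opMul (B ε) (S ε x)) (opMul (B ε) (Sbar ε x)) (n₀ ε) b m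
        = ((wave (u b) ε x * timeTangent (u b) j a x ε 1 : PowerSeries ℂ) : ℂ⸨X⸩).coeff m
          + if a = b then (wave (u b) ε x : ℂ⸨X⸩).coeff (m + (j : ℕ)) else 0 := by
  obtain ⟨B, hB, hBS⟩ := hToda.exists_flow_rowCoeff hx j a
  refine ⟨B, hB, fun b m => ?_⟩
  have hψ := eventually_rowCoeff_line hToda hQC hx 0 0 b (m + (j : ℕ))
  have hder : ∀ᶠ ε in 𝓝[>] (0 : ℝ),
      HasDerivAt (fun z : ℂ => rowCoeff (S ε (moveT j a z x)) (Sbar ε (moveT j a z x)) (n₀ ε) b m)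
        (((wave (u b) ε x * timeTangent (u b) j a x ε 1 : PowerSeries ℂ) : ℂ⸨X⸩).coeff m / ε)
        0 := by
    rcases lt_or_ge m 0 with hm | hm
    · refine Eventually.of_forall fun ε => ?_
      simp only [rowCoeff_of_neg (hToda.minus _ _) (hToda.plus _ _) _ _ hm,
        coeff_coe_of_neg _ hm, zero_div]
      exact hasDerivAt_const _ _
    · lift m to ℕ using hm
      filter_upwards [eventually_rowCoeff_time hQC hx j a b m,
        eventually_timeTangent (hQC.smooth x hx b)
          (eventually_differentiableAt_wave hToda hQC hx j a b) m] with ε h1 h2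
      rw [coeff_coe_natCast]
      exact h2.2.congr_of_eventuallyEq h1
  filter_upwards [hBS b m, hder, hψ, self_mem_nhdsWithin] with ε h1 h2 h3 hε
  have hε' : (ε : ℂ) ≠ 0 := by exact_mod_cast ne_of_gt hε
  rw [linePoint_zero] at h3
  have h4 := h1.unique h2
  rw [h3, div_eq_inv_mul] at h4
  rw [← mul_left_cancel₀ (inv_ne_zero hε') h4, sub_add_cancel]

/-! ### The dispersionless limit of the flows -/

theorem coeff_timeTangent_of_lt (hQC : IsQuasiClassical n₀ U S Sbar u) (x : Params N) (j : ℕ+)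
    (a b : Idx N) (ε : ℝ) {m : ℤ} (hm : m < lowest b) :
    (timeTangent (u b) j a x ε 1 : ℂ⸨X⸩).coeff m = 0 := by
  rcases lt_or_ge m 0 with h | h
  · exact coeff_coe_of_neg _ h
  · by_cases hb : b = one
    · subst hb
      have : m = ((0 : ℕ) : ℤ) := by
        simp only [lowest, if_true] at hm
        omega
      rw [this, coeff_coe_natCast, timeTangent, coeff_mk]
      simp [hQC.normalized]
    · simp only [lowest, if_neg hb] at hm
      omega

/-- At `b = a` this is the triangular system. At `b = c` the shift contributes `w^i`, and at the
remaining punctures no power of `w`, so nothing negative occurs. The choice of `lo` reflects the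
normalization at `1`: for `a = 1` the power `w^0` must be matched too, which uses `i = 0`; for `c =
1` the term `i = 0` is left out, since it would produce a constant at `1`. -/
theorem coeff_flowDefect_of_lt (hQC : IsQuasiClassical n₀ U S Sbar u) (x : Params N) (j : ℕ+)
    {a c : Idx N} (hac : a ≠ c) (h1 : a = one ∨ c = one) (b : Idx N) {lo : ℕ}
    (hlo : lo = if a = one then 0 else 1) (ε : ℝ) {m : ℤ} (hm : m < lowest b) :
    (flowDefect u x j a c b lo ε).coeff m = 0 := by
  rw [coeff_flowDefect, coeff_timeTangent_of_lt hQC x j a b ε hm]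
  by_cases hb : a = b
  · subst hb
    have hκ : shiftExp a c a = -1 := by simp [shiftExp, hac]
    have hq : (lo : ℤ) ≤ -m := by
      rw [hlo]
      simp only [lowest] at hm
      split_ifs at hm ⊢ <;> push_cast <;> omega
    obtain ⟨q, hq'⟩ : ∃ q : ℕ, m = -(q : ℤ) := ⟨(-m).toNat, by omega⟩
    have := sum_flowCoeff (u a) (dir a c) x j lo ε (q := q) (by omega)
    have e : ∀ i : ℕ, m - (i : ℤ) * -1 = (i : ℤ) - q := fun i => by rw [hq']; ring
    simp only [hκ, e, this]
    simp [hq']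
  · rw [if_neg hb, zero_add, zero_sub, neg_eq_zero]
    refine Finset.sum_eq_zero fun i hi => ?_
    rw [Finset.mem_Icc] at hi
    rw [coeff_coe_of_neg _ ?_, mul_zero]
    have hba : b ≠ a := Ne.symm hb
    simp only [shiftExp, if_neg hba, sub_zero]
    by_cases hc : b = c
    · rw [if_pos hc]
      by_cases hb1 : b = one
      · have ha1 : a ≠ one := fun h => hb (h.trans hb1.symm)
        simp only [lowest, if_pos hb1] at hm
        rw [if_neg ha1] at hlo
        omega
      · simp only [lowest, if_neg hb1] at hm
        omega
    · rw [if_neg hc]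
      have hb1 : b ≠ one := by
        rintro rfl
        rcases h1 with h | h
        · exact hb h
        · exact hc h.symm
      simp only [lowest, if_neg hb1] at hm
      omega

theorem eventually_coeff_flowDefect_mul_wave (hToda : IsTodaSolution n₀ U S Sbar)
    (hQC : IsQuasiClassical n₀ U S Sbar u) {x : Params N} (hx : x ∈ U) (j : ℕ+)
    {a c : Idx N} (hac : a ≠ c) (h1 : a = one ∨ c = one) {lo : ℕ}
    (hlo : lo = if a = one then 0 else 1) (b : Idx N) (m : ℤ) : ∀ᶠ ε in 𝓝[>] (0 : ℝ),
    (flowDefect u x j a c b lo ε * (wave (u b) ε x : ℂ⸨X⸩)).coeff m = 0 := by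
  obtain ⟨B, hB, hBS⟩ := exists_flow_wave hToda hQC hx j a
  choose A hA hAS using fun i => hToda.exists_iterate_rowCoeff hx hac i
  have hA' : ∀ ε, ∀ i ∈ Finset.Icc lo (j : ℕ), IsBanded j (A i ε) := fun ε i hi =>
    (hA i ε).mono (Finset.mem_Icc.1 hi).2
  have key : ∀ b m, ∀ᶠ ε in 𝓝[>] (0 : ℝ),
      rowCoeff
        (opMul (B ε - ∑ i ∈ Finset.Icc lo (j : ℕ), flowCoeff (u a) (dir a c) x j ε i • A i ε) (S ε x))
        (opMul (B ε - ∑ i ∈ Finset.Icc lo (j : ℕ), flowCoeff (u a) (dir a c) x j ε i • A i ε)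
          (Sbar ε x)) (n₀ ε) b m
      = (flowDefect u x j a c b lo ε * (wave (u b) ε x : ℂ⸨X⸩)).coeff m := by
    intro b m
    have h2 : ∀ᶠ ε in 𝓝[>] (0 : ℝ), ∀ i ∈ Finset.Icc lo (j : ℕ),
        rowCoeff (opMul (A i ε) (S ε x)) (opMul (A i ε) (Sbar ε x)) (n₀ ε) b m
          = (wave (u b) ε (linePoint (dir a c) x i ε) : ℂ⸨X⸩).coeff (m - i * shiftExp a c b) := by
      refine (eventually_all_finset _).2 fun i _ => ?_
      filter_upwards [hAS i b m, eventually_rowCoeff_line hToda hQC hx (dir a c) i b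
        (m - i * shiftExp a c b)] with ε h3 h4
      rw [h3, h4]
    filter_upwards [hBS b m, h2] with ε h3 h4
    rw [rowCoeff_opMul_sub_sum _ _ (hB ε) (hA' ε), coeff_flowDefect_mul_wave, h3]
    congr 1
    exact Finset.sum_congr rfl fun i hi => by rw [h4 i hi]
  -- Only finitely many coefficients have to be tested, so one threshold for `ε` serves them all.
  have hlow : ∀ᶠ ε in 𝓝[>] (0 : ℝ), ∀ b, ∀ m ∈ Finset.Icc (-(((j : ℕ) : ℤ) + 1)) 1, _ :=
    eventually_all.2 fun b => (eventually_all_finset _).2 fun m _ => key b m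
  filter_upwards [hlow, key b m] with ε h2 h3
  rw [← h3]
  refine rowCoeff_opMul_eq_zero (isBanded_sub_sum _ _ (hB ε) (hA' ε)) (hToda.minus _ _)
    (hToda.plus _ _) _ (fun b m hm hm' => ?_) b m
  have hl : lowest b ≤ 1 := by
    rw [lowest]
    split_ifs <;> omega
  rw [h2 b m (Finset.mem_Icc.2 ⟨hm, by omega⟩)]
  exact coeff_mul_coe_eq_zero _ fun m' hm'' =>
    coeff_flowDefect_of_lt hQC x j hac h1 b hlo ε (by omega)

/-- Division by the wave is multiplication by a power series: the coefficient at `m` involves only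
those up to `m`, and the negative ones vanish identically. -/
theorem eventually_coeff_flowDefect (hToda : IsTodaSolution n₀ U S Sbar)
    (hQC : IsQuasiClassical n₀ U S Sbar u) {x : Params N} (hx : x ∈ U) (j : ℕ+)
    {a c : Idx N} (hac : a ≠ c) (h1 : a = one ∨ c = one) {lo : ℕ}
    (hlo : lo = if a = one then 0 else 1) (b : Idx N) (m : ℤ) : ∀ᶠ ε in 𝓝[>] (0 : ℝ),
    (flowDefect u x j a c b lo ε).coeff m = 0 := by
  have h2 : ∀ᶠ ε in 𝓝[>] (0 : ℝ), ∀ m' ∈ Finset.Icc 0 m,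
      (flowDefect u x j a c b lo ε * (wave (u b) ε x : ℂ⸨X⸩)).coeff m' = 0 :=
    (eventually_all_finset _).2 fun m' _ =>
      eventually_coeff_flowDefect_mul_wave hToda hQC hx j hac h1 hlo b m'
  filter_upwards [h2] with ε h2
  have hinv : flowDefect u x j a c b lo ε = flowDefect u x j a c b lo ε *
      (wave (u b) ε x : ℂ⸨X⸩) * (expSeries (-mk fun i => u b i ε x / ε) : ℂ⸨X⸩) := by
    rw [mul_assoc, ← PowerSeries.coe_mul, wave, mul_comm (expSeries _), expSeries_neg_mul,
      PowerSeries.coe_one, mul_one]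
  rw [hinv]
  refine coeff_mul_coe_eq_zero _ fun m' hm' => ?_
  rcases lt_or_ge m' 0 with h | h
  · have hl : 0 ≤ lowest b := by
      rw [lowest]
      split_ifs <;> omega
    exact coeff_mul_coe_eq_zero _ fun m'' hm'' =>
      coeff_flowDefect_of_lt hQC x j hac h1 b hlo ε (by omega)
  · exact h2 m' (Finset.mem_Icc.2 ⟨h, hm'⟩)

/-- In the dispersionless limit, the flow `t_{ja}` is at every puncture `b` the same polynomial in
the limit `w^κ exp (∂ u_b)` of the shift `T_{(a,c)}`. -/
theorem exists_timeTangent_eq_sum (hToda : IsTodaSolution n₀ U S Sbar)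
    (hQC : IsQuasiClassical n₀ U S Sbar u) {x : Params N} (hx : x ∈ U) (j : ℕ+)
    {a c : Idx N} (hac : a ≠ c) (h1 : a = one ∨ c = one) {lo : ℕ}
    (hlo : lo = if a = one then 0 else 1) :
    ∃ γ : ℕ → ℂ, ∀ b, (timeTangent (u b) j a x 0 1 : ℂ⸨X⸩)
        + (if a = b then HahnSeries.single (-((j : ℕ) : ℤ)) 1 else 0)
      = ∑ i ∈ Finset.Icc lo (j : ℕ), HahnSeries.C (γ i) *
          (HahnSeries.single (shiftExp a c b) 1 *
            (expSeries (chargeTangent (u b) (dir a c) x) : ℂ⸨X⸩)) ^ i := by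
  have hs := hQC.smooth x hx
  have hE : ∀ b i n, Tendsto
      (fun ε => coeff n (expSeries (chargeQuotient (u b) (dir a c) x i ε))) (𝓝[>] 0)
      (𝓝 (coeff n (expSeries (i • chargeTangent (u b) (dir a c) x)))) := fun b i =>
    tendsto_coeff_expSeries fun n => tendsto_coeff_chargeQuotient (hs b n) (dir a c) a i
  refine ⟨fun i => triangularSolution
    (fun k => expSeries (((j : ℕ) - k) • chargeTangent (u a) (dir a c) x))
    (fun m => if m = 0 then 1 else 0) ((j : ℕ) - i), fun b => ?_⟩
  have hc : ∀ i, Tendsto (fun ε => flowCoeff (u a) (dir a c) x j ε i) (𝓝[>] 0)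
      (𝓝 (triangularSolution
        (fun k => expSeries (((j : ℕ) - k) • chargeTangent (u a) (dir a c) x))
        (fun m => if m = 0 then 1 else 0) ((j : ℕ) - i))) := fun i =>
    tendsto_triangularSolution _ (fun k n => hE a _ n) (fun k => by
      rw [constantCoeff_expSeries]; exact Complex.exp_ne_zero _) _
  ext m
  have hlim := (((tendsto_coeff_coe (fun n => tendsto_coeff_timeTangent (hs b) (j := j) (a := a) 1 n)
    m).add (tendsto_const_nhds
      (x := if a = b then if m = -((j : ℕ) : ℤ) then (1 : ℂ) else 0 else 0))).sub
    (tendsto_finsetSum (Finset.Icc lo (j : ℕ)) fun i _ =>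
      (hc i).mul (tendsto_coeff_coe (hE b i) (m - i * shiftExp a c b)))).congr fun ε =>
        (coeff_flowDefect u x j a c b lo ε m).symm
  have hzero := tendsto_nhds_unique
    (tendsto_const_nhds.congr' ((eventually_coeff_flowDefect hToda hQC hx j hac h1 hlo b m).mono
      fun ε h => h.symm)) hlim
  rw [eq_comm, sub_eq_zero] at hzero
  rw [HahnSeries.coeff_add, HahnSeries.coeff_sum]
  refine Eq.trans ?_ (hzero.trans ?_)
  · congr 1
    split_ifs with h1 h2
    · rw [h2, HahnSeries.coeff_single_same]
    · rw [HahnSeries.coeff_single_of_ne h2]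
    · rfl
  · refine Finset.sum_congr rfl fun i _ => ?_
    rw [mul_pow, HahnSeries.C_mul_eq_smul, HahnSeries.coeff_smul, smul_eq_mul, HahnSeries.single_pow,
      one_pow, coeff_single_one_mul, ← PowerSeries.coe_pow, expSeries_nsmul, nsmul_eq_mul]

end Rows

/-! ### Compositional inverses -/

/-- A right inverse is the two-sided one: substitute `F(w) = X` into the left inverse identity. -/
theorem eq_substInv_of_subst_eq_X {F w : PowerSeries ℂ} (hF : constantCoeff F = 0)
    (hF' : IsUnit (coeff 1 F)) (hw : constantCoeff w = 0) (h : F.subst w = (X : PowerSeries ℂ)) :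
    w = F.substInvOfIsUnit hF' := by
  have h1 := subst_comp_subst_apply (HasSubst.of_constantCoeff_zero' hF)
    (HasSubst.of_constantCoeff_zero' hw) (F.substInvOfIsUnit hF')
  rw [subst_substInvOfIsUnit_left F hF hF', h, X_subst,
    subst_X (HasSubst.of_constantCoeff_zero' hw)] at h1
  exact h1

theorem ne_zero_of_coeff_one_ne_zero {w : PowerSeries ℂ} (hw : coeff 1 w ≠ 0) : w ≠ 0 := by
  rintro rfl
  exact hw (map_zero _)

theorem exists_inv_eq {w : PowerSeries ℂ} (hw : constantCoeff w = 0) (hw1 : coeff 1 w ≠ 0) :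
    ∃ r : PowerSeries ℂ,
      (w : ℂ⸨X⸩)⁻¹ = HahnSeries.single (-1) (coeff 1 w)⁻¹ + (r : ℂ⸨X⸩) := by
  obtain ⟨g, hg⟩ := X_dvd_iff.2 hw
  have hg0 : constantCoeff g = coeff 1 w := by
    rw [hg, ← coeff_zero_eq_constantCoeff_apply, ← coeff_succ_X_mul 0]
  have hg1 : constantCoeff g ≠ 0 := by rwa [hg0]
  obtain ⟨r, hr⟩ := X_dvd_iff.2 (show constantCoeff (g⁻¹ - C (coeff 1 w)⁻¹) = 0 by
    rw [map_sub, constantCoeff_inv, hg0]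
    simp)
  refine ⟨r, ?_⟩
  rw [sub_eq_iff_eq_add] at hr
  have h1 : (w : ℂ⸨X⸩) * (HahnSeries.single (-1) 1 * ((g⁻¹ : PowerSeries ℂ) : ℂ⸨X⸩)) = 1 := by
    rw [hg, PowerSeries.coe_mul, PowerSeries.coe_X, mul_mul_mul_comm, HahnSeries.single_mul_single,
      ← PowerSeries.coe_mul, PowerSeries.mul_inv_cancel _ hg1]
    simp
  rw [inv_eq_of_mul_eq_one_right h1, hr, PowerSeries.coe_add, PowerSeries.coe_mul,
    PowerSeries.coe_X, PowerSeries.coe_C, mul_add, ← mul_assoc, HahnSeries.single_mul_single,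
    HahnSeries.C_apply, HahnSeries.single_mul_single, add_comm]
  simp

theorem exists_comp_zero_eq_C (f : ℂ⸨X⸩) : ∃ c : ℂ, comp f 0 = HahnSeries.C c := by
  rw [comp, PowerSeries.coe_zero, PowerSeries.subst_zero_eq_C_constantCoeff]
  by_cases h : f.order = 0
  · refine ⟨constantCoeff f.powerSeriesPart, ?_⟩
    rw [h, zpow_zero, one_mul]
    exact PowerSeries.coe_C _
  · exact ⟨0, by rw [zero_zpow _ h, zero_mul, map_zero]⟩

/-- Composition with `w = 0` returns a constant by convention, whereas `p` is not constant in its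
local parameter. This rules out the degenerate candidate in the uniqueness of Lax functions. -/
theorem ne_zero_of_comp_eq_localP [NeZero N] {f : ℂ⸨X⸩} {w : PowerSeries ℂ} {Q : Idx N → ℂ}
    {b : Idx N} (h : comp f w = localP Q b) : w ≠ 0 := by
  rintro rfl
  obtain ⟨c, hc⟩ := exists_comp_zero_eq_C f
  rw [hc, localP] at h
  split_ifs at h
  · have := congrArg (fun g => HahnSeries.coeff g (-1)) h
    simp [HahnSeries.C_apply] at this
  · have := congrArg (fun g => HahnSeries.coeff g 1) h
    simp [HahnSeries.C_apply] at this

/-! ### Derivatives of the leading phases -/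

theorem HasExpNegDeriv.unique {b : Idx N} {f : ℝ → FormalPhase} {E E' : ℂ⸨X⸩}
    (h : HasExpNegDeriv b f E) (h' : HasExpNegDeriv b f E') : E = E' := by
  obtain ⟨c, D, h1, h2, rfl⟩ := h
  obtain ⟨c', D', h1', h2', rfl⟩ := h'
  have hc : c = c' := by exact_mod_cast h1.unique h1'
  have hD : D = D' := by
    ext n
    have := (h2 n).unique (h2' n)
    rwa [coeff_coe_natCast, coeff_coe_natCast] at this
  rw [hc, hD]

theorem dir_apply (a c b : Idx N) :
    ((dir a c : ZeroCharge N) : Idx N → ℝ) b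
      = (if b = a then 1 else 0) - (if b = c then 1 else 0) := by
  simp [dir, Pi.single_apply]

theorem dir_swap (a c : Idx N) : dir c a = -dir a c := by
  ext b
  simp [dir]

theorem chargeTangent_dir_swap (u : ℕ → ℝ → Params N → ℂ) (a c : Idx N) (x : Params N) :
    chargeTangent u (dir c a) x = -chargeTangent u (dir a c) x := by
  ext m
  simp only [chargeTangent, coeff_mk, map_neg]
  have := deriv_comp_neg (fun s : ℝ => u m 0 (x.1 + s • dir a c, x.2)) 0
  simp only [neg_zero] at this
  rw [← this, dir_swap a c]
  simp only [smul_neg]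
  refine congrArg (fun g : ℝ → ℂ => deriv g 0) (funext fun s => ?_)
  have h : (-s) • dir a c = -(s • dir a c) := by
    ext b
    simp
  rw [h]

theorem shiftExp_swap (a c b : Idx N) : shiftExp c a b = -shiftExp a c b := by
  simp [shiftExp]

theorem sg_mul_self (b : Idx N) : sg b * sg b = 1 := by
  cases b <;> rfl

/-- The limit `w^{-κ} exp (-∂ u_b)` of the inverse of the shift `T_{(a,1)}` at the puncture `b`. -/
def shiftSymbol [NeZero N] (u : Idx N → ℕ → ℝ → Params N → ℂ) (x : Params N) (a b : Idx N) :
    ℂ⸨X⸩ :=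
  HahnSeries.single (-shiftExp a one b) 1 *
    (expSeries (-chargeTangent (u b) (dir a one) x) : ℂ⸨X⸩)

/-- The derivative of the leading phase at the puncture `b` with respect to `t_{ja}`. -/
def timeSymbol (u : Idx N → ℕ → ℝ → Params N → ℂ) (x : Params N) (j : ℕ+) (a b : Idx N) :
    ℂ⸨X⸩ :=
  (timeTangent (u b) j a x 0 1 : ℂ⸨X⸩)
    + (if a = b then HahnSeries.single (-((j : ℕ) : ℤ)) 1 else 0)

theorem hasExpNegDeriv_leadingPhase [NeZero N] (ν : ℝ) {u : Idx N → ℕ → ℝ → Params N → ℂ}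
    {x : Params N} {b : Idx N} (hs : ∀ i, SmoothAtZero x (u b i)) (a : Idx N) :
    HasExpNegDeriv b (fun h => leadingPhase ν u b (moveS a one h x)) (shiftSymbol u x a b) := by
  -- The coefficient of `log z` has derivative `sg b` times the increment of `s_b`; since `sg b`
  -- squares to one, the resulting power of `w` is `-shiftExp a one b`.
  refine ⟨-(sg b * shiftExp a one b), chargeTangent (u b) (dir a one) x, ?_, fun n => ?_, ?_⟩
  · have h1 : HasDerivAt (fun h : ℝ => (ν : ℂ) + sg b *
        (((x.1 : Idx N → ℝ) b : ℂ) + (h : ℂ) * (((dir a one : ZeroCharge N) : Idx N → ℝ) b : ℂ)))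
        (sg b * (((dir a one : ZeroCharge N) : Idx N → ℝ) b : ℂ)) 0 := by
      have := (((Complex.ofRealCLM.hasDerivAt (x := (0 : ℝ))).mul_const
        (((dir a one : ZeroCharge N) : Idx N → ℝ) b : ℂ)).const_add
          ((x.1 : Idx N → ℝ) b : ℂ)).const_mul (sg b : ℂ) |>.const_add (ν : ℂ)
      simpa using this
    refine (h1.congr_of_eventuallyEq (Eventually.of_forall fun h => ?_)).congr_deriv ?_
    · simp [leadingPhase, moveS]
    · rw [dir_apply, shiftExp]
      split_ifs <;> simp
  · simp only [leadingPhase, HahnSeries.coeff_add]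
    refine HasDerivAt.const_add ((x.2.sum fun q t => if q.2 = b then
      (HahnSeries.single (-((q.1 : ℕ) : ℤ)) t : ℂ⸨X⸩) else 0).coeff n) ?_
    rcases lt_or_ge n 0 with hn | hn
    · simp only [coeff_coe_of_neg _ hn]
      exact hasDerivAt_const _ _
    · lift n to ℕ using hn
      simp only [coeff_coe_natCast, coeff_mk]
      exact hasDerivAt_chargeTangent (hs n) (dir a one) a
  · rw [shiftSymbol, mul_neg, ← mul_assoc, sg_mul_self, one_mul]

theorem hasTimeDeriv_leadingPhase (ν : ℝ) {u : Idx N → ℕ → ℝ → Params N → ℂ}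
    {x : Params N} {j : ℕ+} {a b : Idx N}
    (hd : ∀ m, HasDerivAt (fun z : ℂ => u b m 0 (moveT j a z x))
      (coeff m (timeTangent (u b) j a x 0 1)) 0) :
    HasTimeDeriv (fun h => leadingPhase ν u b (moveT j a h x)) (timeSymbol u x j a b) := by
  refine ⟨hasDerivAt_const (0 : ℂ) (leadingPhase ν u b x).log, fun n => ?_⟩
  simp only [leadingPhase, timeSymbol, HahnSeries.coeff_add]
  rw [add_comm]
  refine HasDerivAt.add ?_ ?_
  · have h1 : ∀ h : ℂ, ((moveT j a h x).2.sum fun q t =>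
        if q.2 = b then (HahnSeries.single (-((q.1 : ℕ) : ℤ)) t : ℂ⸨X⸩) else 0)
        = (x.2.sum fun q t => if q.2 = b then (HahnSeries.single (-((q.1 : ℕ) : ℤ)) t : ℂ⸨X⸩) else 0)
          + if a = b then HahnSeries.single (-((j : ℕ) : ℤ)) h else 0 := by
      intro h
      rw [moveT, Finsupp.sum_add_index', Finsupp.sum_single_index]
      · simp
      · intro q; simp
      · intro q s t
        split_ifs
        · exact HahnSeries.single_add _ _ _
        · simp
    simp only [h1, HahnSeries.coeff_add]
    refine HasDerivAt.const_add _ ?_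
    split_ifs
    · by_cases hn : n = -((j : ℕ) : ℤ)
      · subst hn
        simp only [HahnSeries.coeff_single_same]
        exact hasDerivAt_id _
      · simp only [HahnSeries.coeff_single_of_ne hn]
        exact hasDerivAt_const _ _
    · exact hasDerivAt_const _ _
  · rcases lt_or_ge n 0 with hn | hn
    · simp only [coeff_coe_of_neg _ hn]
      exact hasDerivAt_const _ _
    · lift n to ℕ using hn
      simp only [coeff_coe_natCast, coeff_mk]
      exact hd n

/-! ### Functions on the dispersionless curve -/

section Curve

variable [NeZero N] {u : Idx N → ℕ → ℝ → Params N → ℂ}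

theorem constantCoeff_chargeTangent_one (hQC : IsQuasiClassical n₀ U S Sbar u)
    (v : ZeroCharge N) (x : Params N) : constantCoeff (chargeTangent (u one) v x) = 0 := by
  rw [← coeff_zero_eq_constantCoeff_apply, chargeTangent, coeff_mk]
  simp [hQC.normalized]

theorem shiftSymbol_eq (u : Idx N → ℕ → ℝ → Params N → ℂ) (x : Params N) (a b : Idx N) :
    HahnSeries.single (shiftExp one a b) 1 *
      (expSeries (chargeTangent (u b) (dir one a) x) : ℂ⸨X⸩) = shiftSymbol u x a b := by
  rw [shiftSymbol, shiftExp_swap a one, chargeTangent_dir_swap _ a one]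

theorem inv_shiftSymbol (u : Idx N → ℕ → ℝ → Params N → ℂ) (x : Params N) (a b : Idx N) :
    HahnSeries.single (shiftExp a one b) 1 *
      (expSeries (chargeTangent (u b) (dir a one) x) : ℂ⸨X⸩) = (shiftSymbol u x a b)⁻¹ := by
  refine (inv_eq_of_mul_eq_one_right ?_).symm
  rw [shiftSymbol, mul_mul_mul_comm, HahnSeries.single_mul_single, ← PowerSeries.coe_mul,
    expSeries_neg_mul]
  simp

/-- The flows of the puncture `1` are expanded in `T_{(1,a)}`, where `a ≠ 1` is arbitrary. This
freedom relates the different charge derivatives to each other. -/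
theorem exists_timeSymbol_one_eq (hToda : IsTodaSolution n₀ U S Sbar)
    (hQC : IsQuasiClassical n₀ U S Sbar u) {x : Params N} (hx : x ∈ U) {a : Idx N}
    (ha : a ≠ one) (j : ℕ+) : ∃ γ : ℕ → ℂ, ∀ b, timeSymbol u x j one b
      = ∑ i ∈ Finset.range ((j : ℕ) + 1), HahnSeries.C (γ i) * shiftSymbol u x a b ^ i := by
  obtain ⟨γ, hγ⟩ := exists_timeTangent_eq_sum hToda hQC hx j (Ne.symm ha) (Or.inl rfl)
    (if_pos rfl).symm
  refine ⟨γ, fun b => ?_⟩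
  have := hγ b
  simp only [shiftSymbol_eq] at this
  rw [timeSymbol, this]
  refine Finset.sum_congr ?_ fun _ _ => rfl
  ext i
  simp

theorem exists_timeSymbol_eq (hToda : IsTodaSolution n₀ U S Sbar)
    (hQC : IsQuasiClassical n₀ U S Sbar u) {x : Params N} (hx : x ∈ U) {a : Idx N}
    (ha : a ≠ one) (j : ℕ+) : ∃ γ : ℕ → ℂ, ∀ b, timeSymbol u x j a b
      = ∑ i ∈ Finset.Icc 1 (j : ℕ), HahnSeries.C (γ i) * (shiftSymbol u x a b)⁻¹ ^ i := by
  obtain ⟨γ, hγ⟩ := exists_timeTangent_eq_sum hToda hQC hx j ha (Or.inr rfl)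
    (if_neg ha).symm
  refine ⟨γ, fun b => ?_⟩
  have := hγ b
  simp only [inv_shiftSymbol] at this
  exact this

theorem exists_timeSymbol_eq_add_C (hToda : IsTodaSolution n₀ U S Sbar)
    (hQC : IsQuasiClassical n₀ U S Sbar u) {x : Params N} (hx : x ∈ U) {a : Idx N}
    (ha : a ≠ one) : ∃ q : ℂ, ∀ b,
      timeSymbol u x 1 one b = shiftSymbol u x a b + HahnSeries.C q := by
  obtain ⟨γ, hγ⟩ := exists_timeSymbol_one_eq hToda hQC hx ha 1
  -- Compare the coefficients of `w⁻¹` at the puncture `1`: the vacuum term gives `1`, and the shift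
  -- symbol has leading coefficient `1` because `u one 0` vanishes.
  have h1 : γ 1 = 1 := by
    have h := congrArg (fun f => HahnSeries.coeff f (-1)) (hγ one)
    have hκ : shiftExp a one one = 1 := by simp [shiftExp, Ne.symm ha]
    simp only [timeSymbol, PNat.val_ofNat, Finset.sum_range_succ, Finset.range_zero,
      Finset.sum_empty, pow_zero, pow_one, zero_add, shiftSymbol, hκ, if_true,
      HahnSeries.coeff_add, HahnSeries.C_mul_eq_smul, HahnSeries.coeff_smul,
      coeff_single_one_mul, coeff_coe_of_neg _ (show (-1 : ℤ) < 0 by norm_num)] at h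
    rw [sub_self, ← Nat.cast_zero (R := ℤ), coeff_coe_natCast, coeff_zero_eq_constantCoeff_apply,
      constantCoeff_expSeries, map_neg, constantCoeff_chargeTangent_one hQC] at h
    simpa [HahnSeries.C_apply, HahnSeries.coeff_single] using h.symm
  refine ⟨γ 0, fun b => ?_⟩
  rw [hγ b, PNat.val_ofNat, Finset.sum_range_succ, Finset.sum_range_one, h1, pow_zero, pow_one,
    mul_one, HahnSeries.C_one, one_mul, add_comm]

/-- The local parameter `τ` of `p` at the puncture `b`, as a power series in `w`. -/
def localParam (u : Idx N → ℕ → ℝ → Params N → ℂ) (a₀ : Idx N) (x : Params N) (b : Idx N) :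
    PowerSeries ℂ :=
  X * expSeries (if b = one then chargeTangent (u b) (dir a₀ one) x
    else -chargeTangent (u b) (dir b one) x)

theorem constantCoeff_localParam (u : Idx N → ℕ → ℝ → Params N → ℂ) (a₀ : Idx N) (x : Params N)
    (b : Idx N) : constantCoeff (localParam u a₀ x b) = 0 := by
  simp [localParam]

theorem coeff_one_localParam (u : Idx N → ℕ → ℝ → Params N → ℂ) (a₀ : Idx N) (x : Params N)
    (b : Idx N) : coeff 1 (localParam u a₀ x b)
      = Complex.exp (constantCoeff (if b = one then chargeTangent (u b) (dir a₀ one) x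
          else -chargeTangent (u b) (dir b one) x)) := by
  rw [localParam, ← zero_add 1, coeff_succ_X_mul, coeff_zero_eq_constantCoeff_apply, constantCoeff_expSeries]

theorem isUnit_coeff_one_localParam (u : Idx N → ℕ → ℝ → Params N → ℂ) (a₀ : Idx N)
    (x : Params N) (b : Idx N) : IsUnit (coeff 1 (localParam u a₀ x b)) := by
  rw [coeff_one_localParam]
  exact (Complex.exp_ne_zero _).isUnit

/-- The function `w_b = z_b^{-sg b}` of the local parameter `τ` of `p` at the puncture `b`. -/
def laxSeries (u : Idx N → ℕ → ℝ → Params N → ℂ) (a₀ : Idx N) (x : Params N) (b : Idx N) :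
    PowerSeries ℂ :=
  (localParam u a₀ x b).substInvOfIsUnit (isUnit_coeff_one_localParam u a₀ x b)

theorem constantCoeff_laxSeries (u : Idx N → ℕ → ℝ → Params N → ℂ) (a₀ : Idx N) (x : Params N)
    (b : Idx N) : constantCoeff (laxSeries u a₀ x b) = 0 :=
  constantCoeff_substInvOfIsUnit _ _

theorem coeff_one_laxSeries (u : Idx N → ℕ → ℝ → Params N → ℂ) (a₀ : Idx N) (x : Params N)
    (b : Idx N) : coeff 1 (laxSeries u a₀ x b) = (coeff 1 (localParam u a₀ x b))⁻¹ := by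
  rw [laxSeries, coeff_one_substInvOfIsUnit]
  simp

theorem coeff_one_laxSeries_ne_zero (u : Idx N → ℕ → ℝ → Params N → ℂ) (a₀ : Idx N)
    (x : Params N) (b : Idx N) : coeff 1 (laxSeries u a₀ x b) ≠ 0 := by
  rw [coeff_one_laxSeries]
  exact inv_ne_zero (isUnit_coeff_one_localParam u a₀ x b).ne_zero

theorem coeff_one_laxSeries_one (hQC : IsQuasiClassical n₀ U S Sbar u) (a₀ : Idx N)
    (x : Params N) : coeff 1 (laxSeries u a₀ x one) = 1 := by
  rw [coeff_one_laxSeries, coeff_one_localParam, if_pos rfl, constantCoeff_chargeTangent_one hQC,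
    Complex.exp_zero, inv_one]

theorem laxSeries_ne_zero (u : Idx N → ℕ → ℝ → Params N → ℂ) (a₀ : Idx N) (x : Params N)
    (b : Idx N) : laxSeries u a₀ x b ≠ 0 :=
  ne_zero_of_coeff_one_ne_zero (coeff_one_laxSeries_ne_zero u a₀ x b)

theorem localParam_subst_laxSeries (u : Idx N → ℕ → ℝ → Params N → ℂ) (a₀ : Idx N) (x : Params N)
    (b : Idx N) : (localParam u a₀ x b).subst (laxSeries u a₀ x b) = (X : PowerSeries ℂ) :=
  subst_substInvOfIsUnit_right _ (constantCoeff_localParam u a₀ x b) _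

/-- The ring homomorphism which inserts `w = w_b(τ)`. -/
def laxHom (u : Idx N → ℕ → ℝ → Params N → ℂ) (a₀ : Idx N) (x : Params N) (b : Idx N) :
    ℂ⸨X⸩ →+* ℂ⸨X⸩ :=
  compHom (constantCoeff_laxSeries u a₀ x b) (laxSeries_ne_zero u a₀ x b)

theorem comp_laxSeries (u : Idx N → ℕ → ℝ → Params N → ℂ) (a₀ : Idx N) (x : Params N)
    (b : Idx N) (f : ℂ⸨X⸩) : comp f (laxSeries u a₀ x b) = laxHom u a₀ x b f :=
  comp_eq_compHom _ _ f

theorem laxHom_C (u : Idx N → ℕ → ℝ → Params N → ℂ) (a₀ : Idx N) (x : Params N)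
    (b : Idx N) (c : ℂ) : laxHom u a₀ x b (HahnSeries.C c) = HahnSeries.C c :=
  compHom_C _ _ c

theorem laxHom_coe (u : Idx N → ℕ → ℝ → Params N → ℂ) (a₀ : Idx N) (x : Params N)
    (b : Idx N) (g : PowerSeries ℂ) : laxHom u a₀ x b (g : ℂ⸨X⸩)
      = ((g.subst (laxSeries u a₀ x b) : PowerSeries ℂ) : ℂ⸨X⸩) :=
  compHom_coe _ _ g

theorem laxHom_single_neg (u : Idx N → ℕ → ℝ → Params N → ℂ) (a₀ : Idx N) (x : Params N)
    (b : Idx N) (n : ℕ) : laxHom u a₀ x b (HahnSeries.single (-(n : ℤ)) 1)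
      = (laxSeries u a₀ x b : ℂ⸨X⸩)⁻¹ ^ n := by
  rw [laxHom, compHom_single, zpow_neg, zpow_natCast, inv_pow]

theorem shiftSymbol_one {a₀ : Idx N} (ha₀ : a₀ ≠ one) (u : Idx N → ℕ → ℝ → Params N → ℂ)
    (x : Params N) : shiftSymbol u x a₀ one = (localParam u a₀ x one : ℂ⸨X⸩)⁻¹ := by
  have hκ : shiftExp a₀ one one = 1 := by simp [shiftExp, Ne.symm ha₀]
  rw [← inv_inv (shiftSymbol u x a₀ one), ← inv_shiftSymbol, hκ, localParam, if_pos rfl,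
    PowerSeries.coe_mul, PowerSeries.coe_X]

theorem shiftSymbol_self {b : Idx N} (hb : b ≠ one) (a₀ : Idx N)
    (u : Idx N → ℕ → ℝ → Params N → ℂ)
    (x : Params N) : shiftSymbol u x b b = (localParam u a₀ x b : ℂ⸨X⸩) := by
  have hκ : shiftExp b one b = -1 := by simp [shiftExp, hb]
  rw [shiftSymbol, hκ, localParam, if_neg hb, PowerSeries.coe_mul, PowerSeries.coe_X, neg_neg]

end Curve

/-! ### The Orlov–Schulman functions -/

theorem coeff_single_one_mul_derivative (f : ℂ⸨X⸩) (n : ℤ) :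
    (HahnSeries.single 1 1 * LaurentSeries.derivative ℂ f).coeff n = n * f.coeff n := by
  rw [coeff_single_one_mul, LaurentSeries.derivative_apply, LaurentSeries.hasseDeriv_coeff]
  simp

theorem coeff_coe_X_mul_derivative (f : PowerSeries ℂ) (n : ℤ) :
    ((X * d⁄dX ℂ f : PowerSeries ℂ) : ℂ⸨X⸩).coeff n = n * (f : ℂ⸨X⸩).coeff n := by
  rcases lt_or_ge n 0 with hn | hn
  · rw [coeff_coe_of_neg _ hn, coeff_coe_of_neg _ hn, mul_zero]
  · lift n to ℕ using hn
    rw [coeff_coe_natCast, coeff_coe_natCast]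
    cases n with
    | zero => simp
    | succ n =>
      rw [coeff_succ_X_mul, coeff_derivative]
      push_cast
      ring

theorem coeff_finsuppSum {ι : Type*} (t : ι →₀ ℂ) (g : ι → ℂ → ℂ⸨X⸩) (n : ℤ) :
    (t.sum g).coeff n = t.sum fun i c => (g i c).coeff n := by
  rw [Finsupp.sum, HahnSeries.coeff_sum]
  rfl

/-- The operator `w d/dw` multiplies `w^n` by `n`. It therefore kills the constant term of the
regular part, which is why the Orlov–Schulman remainder vanishes at the puncture. -/
theorem eulerZ_leadingPhase (ν : ℝ) (u : Idx N → ℕ → ℝ → Params N → ℂ) (b : Idx N)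
    (x : Params N) : eulerZ b (leadingPhase ν u b x)
      = HahnSeries.C ((ν : ℂ) + sg b * ((x.1 : Idx N → ℝ) b : ℂ))
        + HahnSeries.C (sg b : ℂ) * (x.2.sum fun i t => if i.2 = b then
            HahnSeries.C (((i.1 : ℕ) : ℂ) * t) * HahnSeries.single (-((i.1 : ℕ) : ℤ)) 1 else 0)
        + ((-C (sg b : ℂ) * (X * d⁄dX ℂ (mk fun i => u b i 0 x)) : PowerSeries ℂ) : ℂ⸨X⸩) := by
  rw [eulerZ, sub_eq_add_neg, add_assoc]
  congr 1
  ext n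
  rw [neg_mul, PowerSeries.coe_neg, PowerSeries.coe_mul, PowerSeries.coe_C, HahnSeries.coeff_add,
    HahnSeries.coeff_neg, HahnSeries.coeff_neg, HahnSeries.C_mul_eq_smul, HahnSeries.C_mul_eq_smul,
    HahnSeries.C_mul_eq_smul, HahnSeries.coeff_smul, HahnSeries.coeff_smul, HahnSeries.coeff_smul,
    coeff_single_one_mul_derivative, coeff_coe_X_mul_derivative, leadingPhase,
    HahnSeries.coeff_add, coeff_finsuppSum, coeff_finsuppSum, mul_add, smul_add, neg_add]
  congr 1
  rw [← smul_neg]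
  congr 1
  rw [Finsupp.sum, Finsupp.sum, Finset.mul_sum, ← Finset.sum_neg_distrib]
  refine Finset.sum_congr rfl fun i _ => ?_
  split_ifs
  · rw [HahnSeries.C_mul_eq_smul, HahnSeries.coeff_smul, HahnSeries.coeff_single,
      HahnSeries.coeff_single]
    split_ifs with h
    · rw [h, smul_eq_mul]
      push_cast
      ring
    · simp
  · simp

/-! ### The dispersionless Lax functions -/

section Lax

variable [NeZero N] {u : Idx N → ℕ → ℝ → Params N → ℂ}

theorem exists_orlovSchulman_eq (ν : ℝ) (u : Idx N → ℕ → ℝ → Params N → ℂ) (a₀ : Idx N)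
    (x : Params N) (b : Idx N) : ∃ μ : PowerSeries ℂ, PowerSeries.constantCoeff μ = 0 ∧
      orlovSchulman b (leadingPhase ν u b x) (laxSeries u a₀ x b)
        = HahnSeries.C ((ν : ℂ) + sg b * ((x.1 : Idx N → ℝ) b : ℂ))
          + HahnSeries.C (sg b : ℂ) * (x.2.sum fun i t => if i.2 = b then
              HahnSeries.C (((i.1 : ℕ) : ℂ) * t) * ((laxSeries u a₀ x b : ℂ⸨X⸩)⁻¹) ^ (i.1 : ℕ)
              else 0)
          + (μ : ℂ⸨X⸩) := by
  refine ⟨_, constantCoeff_subst_eq_zero (constantCoeff_laxSeries u a₀ x b)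
    (-C (sg b : ℂ) * (X * d⁄dX ℂ (mk fun i => u b i 0 x))) (by simp), ?_⟩
  rw [orlovSchulman, comp_laxSeries, eulerZ_leadingPhase, map_add, map_add, map_mul, laxHom_C,
    laxHom_C, laxHom_coe, map_finsuppSum]
  congr 3
  refine Finsupp.sum_congr fun i _ => ?_
  split_ifs
  · rw [map_mul, laxHom_C, laxHom_single_neg]
  · rw [map_zero]

theorem laxHom_localParam (u : Idx N → ℕ → ℝ → Params N → ℂ) (a₀ : Idx N) (x : Params N)
    (b : Idx N) : laxHom u a₀ x b (localParam u a₀ x b) = HahnSeries.single 1 1 := by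
  rw [laxHom_coe, localParam_subst_laxSeries, PowerSeries.coe_X]

variable {a₀ : Idx N} {x : Params N} {q Q : Idx N → ℂ}

/-- Two expressions for the same `t_{11}`-derivative are subtracted; with `p` for the symbol of `a₀`
this says that the symbol of `a` is `p - Q_a`. -/
theorem shiftSymbol_sub (hq : ∀ a, a ≠ one → ∀ b,
      timeSymbol u x 1 one b = shiftSymbol u x a b + HahnSeries.C (q a))
    (hQ : ∀ a, Q a = q a - q a₀) (ha₀ : a₀ ≠ one) {a : Idx N} (ha : a ≠ one) (b : Idx N) :
    shiftSymbol u x a b = shiftSymbol u x a₀ b - HahnSeries.C (Q a) := by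
  have h1 := hq a ha b
  have h2 := hq a₀ ha₀ b
  rw [hQ, map_sub]
  rw [h1] at h2
  linear_combination h2

theorem shiftSymbol_eq_localParam (hq : ∀ a, a ≠ one → ∀ b,
      timeSymbol u x 1 one b = shiftSymbol u x a b + HahnSeries.C (q a))
    (hQ : ∀ a, Q a = q a - q a₀) (ha₀ : a₀ ≠ one) {b : Idx N} (hb : b ≠ one) :
    shiftSymbol u x a₀ b = HahnSeries.C (Q b) + (localParam u a₀ x b : ℂ⸨X⸩) := by
  rw [← shiftSymbol_self hb a₀, shiftSymbol_sub hq hQ ha₀ hb, add_sub_cancel]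

theorem laxHom_shiftSymbol (hq : ∀ a, a ≠ one → ∀ b,
      timeSymbol u x 1 one b = shiftSymbol u x a b + HahnSeries.C (q a))
    (hQ : ∀ a, Q a = q a - q a₀) (ha₀ : a₀ ≠ one) (b : Idx N) :
    laxHom u a₀ x b (shiftSymbol u x a₀ b) = localP Q b := by
  by_cases hb : b = one
  · subst hb
    rw [shiftSymbol_one ha₀, map_inv₀, laxHom_localParam, localP, if_pos rfl,
      HahnSeries.inv_single, inv_one]
  · rw [shiftSymbol_eq_localParam hq hQ ha₀ hb, map_add, laxHom_C, laxHom_localParam, localP,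
      if_neg hb]

theorem laxHom_shiftSymbol_sub (hq : ∀ a, a ≠ one → ∀ b,
      timeSymbol u x 1 one b = shiftSymbol u x a b + HahnSeries.C (q a))
    (hQ : ∀ a, Q a = q a - q a₀) (ha₀ : a₀ ≠ one) {a : Idx N} (ha : a ≠ one) (b : Idx N) :
    laxHom u a₀ x b (shiftSymbol u x a b) = localP Q b - HahnSeries.C (Q a) := by
  rw [shiftSymbol_sub hq hQ ha₀ ha, map_sub, laxHom_C, laxHom_shiftSymbol hq hQ ha₀]

theorem isLaxFunction_laxSeries (ν : ℝ) (hs : ∀ b i, SmoothAtZero x (u b i))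
    (hq : ∀ a, a ≠ one → ∀ b,
      timeSymbol u x 1 one b = shiftSymbol u x a b + HahnSeries.C (q a))
    (hQ : ∀ a, Q a = q a - q a₀) (ha₀ : a₀ ≠ one) (b : Idx N) :
    IsLaxFunction a₀ Q (leadingPhase ν u) x b (laxSeries u a₀ x b) :=
  ⟨constantCoeff_laxSeries u a₀ x b, shiftSymbol u x a₀ b, hasExpNegDeriv_leadingPhase ν (hs b) a₀,
    by rw [comp_laxSeries, laxHom_shiftSymbol hq hQ ha₀]⟩

/-- Since `p` is the inverse of `localParam` at `1` and `Q_b` plus `localParam` elsewhere, the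
implicit relation says that `w` is a right compositional inverse of `localParam`. -/
theorem IsLaxFunction.eq_laxSeries {ν : ℝ} (hs : ∀ b i, SmoothAtZero x (u b i))
    (hq : ∀ a, a ≠ one → ∀ b,
      timeSymbol u x 1 one b = shiftSymbol u x a b + HahnSeries.C (q a))
    (hQ : ∀ a, Q a = q a - q a₀) (ha₀ : a₀ ≠ one) {b : Idx N} {w : PowerSeries ℂ}
    (h : IsLaxFunction a₀ Q (leadingPhase ν u) x b w) : w = laxSeries u a₀ x b := by
  obtain ⟨hw, P, hP, hcomp⟩ := h
  have hw0 := ne_zero_of_comp_eq_localP hcomp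
  rw [hP.unique (hasExpNegDeriv_leadingPhase ν (hs b) a₀), comp_eq_compHom hw hw0] at hcomp
  refine eq_substInv_of_subst_eq_X (constantCoeff_localParam u a₀ x b) _ hw ?_
  refine HahnSeries.ofPowerSeries_injective (Γ := ℤ) ?_
  rw [← compHom_coe hw hw0, PowerSeries.coe_X]
  by_cases hb : b = one
  · subst hb
    rw [shiftSymbol_one ha₀, map_inv₀, localP, if_pos rfl, inv_eq_iff_eq_inv,
      HahnSeries.inv_single, inv_one, neg_neg] at hcomp
    exact hcomp
  · rw [shiftSymbol_eq_localParam hq hQ ha₀ hb, map_add, compHom_C, localP, if_neg hb,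
      add_right_inj] at hcomp
    exact hcomp

/-- At `b` the symbol of `a ≠ b` carries no power of `w` and is an exponential, hence a unit; if
`Q_a = Q_b` it would equal `p - Q_b`, which vanishes at `b`. -/
theorem puncture_ne (hq : ∀ a, a ≠ one → ∀ b,
      timeSymbol u x 1 one b = shiftSymbol u x a b + HahnSeries.C (q a))
    (hQ : ∀ a, Q a = q a - q a₀) (ha₀ : a₀ ≠ one) {a b : Idx N} (ha : a ≠ one) (hb : b ≠ one)
    (hab : a ≠ b) : Q a ≠ Q b := by
  intro h
  have h1 := shiftSymbol_sub hq hQ ha₀ ha b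
  have hκ : shiftExp a one b = 0 := by simp [shiftExp, hb, Ne.symm hab]
  rw [shiftSymbol_eq_localParam hq hQ ha₀ hb, h, add_sub_cancel_left, shiftSymbol, hκ, neg_zero,
    HahnSeries.single_zero_one, one_mul] at h1
  have h2 := congrArg constantCoeff (HahnSeries.ofPowerSeries_injective h1)
  rw [constantCoeff_localParam, constantCoeff_expSeries] at h2
  exact Complex.exp_ne_zero _ h2

/-! ### The Whitham flows -/

theorem coeff_sum_C_mul_single_pow (s : Finset ℕ) (γ : ℕ → ℂ) {n : ℕ} (hn : n ∈ s) :
    (∑ i ∈ s, HahnSeries.C (γ i) * (HahnSeries.single (-1) 1 : ℂ⸨X⸩) ^ i).coeff (-(n : ℤ))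
      = γ n := by
  rw [HahnSeries.coeff_sum, Finset.sum_eq_single_of_mem n hn]
  · rw [HahnSeries.C_mul_eq_smul, HahnSeries.coeff_smul, HahnSeries.single_pow, one_pow]
    simp
  · intro i _ hi
    rw [HahnSeries.C_mul_eq_smul, HahnSeries.coeff_smul, HahnSeries.single_pow, one_pow,
      HahnSeries.coeff_single_of_ne, smul_zero]
    simpa using Ne.symm hi

/-- Besides `w^{-j}` the symbol has only a power series, invisible in negative degrees; at the
puncture `1` its constant term vanishes as well, so degree `0` is included there. -/
theorem coeff_laxHom_timeSymbol (hQC : IsQuasiClassical n₀ U S Sbar u) (a₀ : Idx N)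
    (x : Params N) (j : ℕ+) (a : Idx N) {n : ℕ} (hn : a = one ∨ n ≠ 0) :
    (laxHom u a₀ x a (timeSymbol u x j a a)).coeff (-(n : ℤ))
      = ((laxSeries u a₀ x a : ℂ⸨X⸩)⁻¹ ^ (j : ℕ)).coeff (-(n : ℤ)) := by
  rw [timeSymbol, if_pos rfl, map_add, laxHom_single_neg, HahnSeries.coeff_add, laxHom_coe,
    add_eq_right]
  rcases Nat.eq_zero_or_pos n with h0 | h0
  · subst h0
    have ha : a = one := hn.resolve_right fun h => h rfl
    subst ha
    rw [Nat.cast_zero, neg_zero, ← Nat.cast_zero (R := ℤ), coeff_coe_natCast,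
      coeff_zero_eq_constantCoeff_apply]
    refine constantCoeff_subst_eq_zero (constantCoeff_laxSeries u a₀ x one) _ ?_
    rw [← coeff_zero_eq_constantCoeff_apply, timeTangent, coeff_mk]
    simp [hQC.normalized]
  · exact coeff_coe_of_neg _ (by omega)

theorem laxHom_timeSymbol (hToda : IsTodaSolution n₀ U S Sbar)
    (hQC : IsQuasiClassical n₀ U S Sbar u) (hx : x ∈ U)
    (hq : ∀ a, a ≠ one → ∀ b,
      timeSymbol u x 1 one b = shiftSymbol u x a b + HahnSeries.C (q a))
    (hQ : ∀ a, Q a = q a - q a₀) (ha₀ : a₀ ≠ one) (j : ℕ+) (a b : Idx N) :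
    laxHom u a₀ x b (timeSymbol u x j a b)
      = Omega Q (fun c => (laxSeries u a₀ x c : ℂ⸨X⸩)⁻¹) j a (localP Q b) := by
  by_cases ha : a = one
  · subst ha
    obtain ⟨γ, hγ⟩ := exists_timeSymbol_one_eq hToda hQC hx ha₀ j
    have key : ∀ b, laxHom u a₀ x b (timeSymbol u x j one b)
        = ∑ i ∈ Finset.range ((j : ℕ) + 1), HahnSeries.C (γ i) * localP Q b ^ i := by
      intro b
      rw [hγ, map_sum]
      refine Finset.sum_congr rfl fun i _ => ?_
      rw [map_mul, laxHom_C, map_pow, laxHom_shiftSymbol hq hQ ha₀]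
    rw [key, Omega, if_pos rfl]
    refine Finset.sum_congr rfl fun n hn => ?_
    -- At the puncture `1` itself `p` is `τ⁻¹`, so the coefficients `γ` are the Laurent coefficients
    -- of the symbol and, being common to all punctures, can be inserted at `b`.
    have h1 := coeff_laxHom_timeSymbol hQC a₀ x j one (n := n) (Or.inl rfl)
    rw [key, localP, if_pos rfl, coeff_sum_C_mul_single_pow _ _ hn] at h1
    rw [h1]
  · obtain ⟨γ, hγ⟩ := exists_timeSymbol_eq hToda hQC hx ha j
    have key : ∀ b, laxHom u a₀ x b (timeSymbol u x j a b)
        = ∑ i ∈ Finset.Icc 1 (j : ℕ),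
            HahnSeries.C (γ i) * (localP Q b - HahnSeries.C (Q a))⁻¹ ^ i := by
      intro b
      rw [hγ, map_sum]
      refine Finset.sum_congr rfl fun i _ => ?_
      rw [map_mul, laxHom_C, map_pow, map_inv₀, laxHom_shiftSymbol_sub hq hQ ha₀ ha]
    rw [key, Omega, if_neg ha]
    refine Finset.sum_congr rfl fun n hn => ?_
    -- The same reading at the puncture `a`, where `(p - Q_a)⁻¹` is `τ⁻¹`.
    have h1 := coeff_laxHom_timeSymbol hQC a₀ x j a (n := n)
      (Or.inr (by have := (Finset.mem_Icc.1 hn).1; omega))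
    rw [key, localP, if_neg ha, add_sub_cancel_left, HahnSeries.inv_single, inv_one,
      coeff_sum_C_mul_single_pow _ _ hn] at h1
    rw [h1]

end Lax

end

end MultiToda

open MultiToda in
theorem mainTheorem9 (N : ℕ) [NeZero N] (a₀ : Idx N) (ha₀ : a₀ ≠ one)
    (n₀ : ℝ → ℤ) (ν : ℝ) (hν : Tendsto (fun ε : ℝ => ε * (n₀ ε : ℝ)) (𝓝[>] 0) (𝓝 ν))
    (U : Set (Params N)) (S Sbar : ℝ → Params N → Op N)
    (u : Idx N → ℕ → ℝ → Params N → ℂ)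
    (hToda : IsTodaSolution n₀ U S Sbar) (hQC : IsQuasiClassical n₀ U S Sbar u) :
    ∃ (q : Params N → Idx N → ℂ) (Q : Params N → Idx N → ℂ)
      (w : Params N → Idx N → PowerSeries ℂ),
      (∀ x a, Q x a = q x a - q x a₀) ∧
      (∀ x ∈ U, ∀ a b, a ≠ one → ∃ D E : ℂ⸨X⸩,
        HasTimeDeriv (fun h => leadingPhase ν u b (moveT 1 one h x)) D ∧
        HasExpNegDeriv b (fun h => leadingPhase ν u b (moveS a one h x)) E ∧
        D = E + HahnSeries.C (q x a)) ∧
      (∀ x ∈ U, ∀ b, IsLaxFunction a₀ (Q x) (leadingPhase ν u) x b (w x b) ∧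
        ∀ w' : PowerSeries ℂ,
          IsLaxFunction a₀ (Q x) (leadingPhase ν u) x b w' → w' = w x b) ∧
      (∀ x ∈ U, ∃ r : PowerSeries ℂ,
        (w x one : ℂ⸨X⸩)⁻¹ = HahnSeries.single (-1) 1 + (r : ℂ⸨X⸩)) ∧
      (∀ x ∈ U, ∀ b, b ≠ one → ∃ (ℓ : ℂ) (r : PowerSeries ℂ), ℓ ≠ 0 ∧
        (w x b : ℂ⸨X⸩)⁻¹ = HahnSeries.single (-1) ℓ + (r : ℂ⸨X⸩)) ∧
      (∀ x ∈ U, ∀ b, ∃ μ : PowerSeries ℂ, PowerSeries.constantCoeff μ = 0 ∧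
        orlovSchulman b (leadingPhase ν u b x) (w x b)
          = HahnSeries.C ((ν : ℂ) + sg b * ((x.1 : Idx N → ℝ) b : ℂ))
            + HahnSeries.C (sg b : ℂ) * (x.2.sum fun i t =>
                if i.2 = b then HahnSeries.C (((i.1 : ℕ) : ℂ) * t) * ((w x b : ℂ⸨X⸩)⁻¹) ^ (i.1 : ℕ)
                else 0)
            + (μ : ℂ⸨X⸩)) ∧
      IsTodaWhithamSolution a₀ U Q w (leadingPhase ν u) := by
  -- Outside `U`, and for `a = 1`, the value of `q` is an irrelevant default; this makes it a total
  -- function before choice is applied.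
  have hex : ∀ x a, ∃ q : ℂ, x ∈ U → a ≠ one → ∀ b,
      timeSymbol u x 1 one b = shiftSymbol u x a b + HahnSeries.C q := by
    intro x a
    by_cases h : x ∈ U ∧ a ≠ one
    · obtain ⟨q, hq⟩ := exists_timeSymbol_eq_add_C hToda hQC h.1 h.2
      exact ⟨q, fun _ _ => hq⟩
    · exact ⟨0, fun h1 h2 => absurd ⟨h1, h2⟩ h⟩
  choose q hq using hex
  have hs := hQC.smooth
  have htime : ∀ x ∈ U, ∀ (j : ℕ+) (a b : Idx N),
      HasTimeDeriv (fun h => leadingPhase ν u b (moveT j a h x)) (timeSymbol u x j a b) :=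
    fun x hx j a b => hasTimeDeriv_leadingPhase ν (hasDerivAt_time (hs x hx b)
      (eventually_differentiableAt_wave hToda hQC hx j a b))
  have hQ : ∀ x a, q x a - q x a₀ = q x a - q x a₀ := fun _ _ => rfl
  refine ⟨q, fun x a => q x a - q x a₀, fun x b => laxSeries u a₀ x b, hQ, ?_, ?_, ?_, ?_, ?_, ?_⟩
  · exact fun x hx a b ha => ⟨_, _, htime x hx 1 one b,
      hasExpNegDeriv_leadingPhase ν (hs x hx b) a, hq x a hx ha b⟩
  · exact fun x hx b =>
      ⟨isLaxFunction_laxSeries ν (hs x hx) (fun a => hq x a hx) (hQ x) ha₀ b,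
        fun w' hw' => hw'.eq_laxSeries (hs x hx) (fun a => hq x a hx) (hQ x) ha₀⟩
  · intro x hx
    obtain ⟨r, hr⟩ := exists_inv_eq (constantCoeff_laxSeries u a₀ x one)
      (coeff_one_laxSeries_ne_zero u a₀ x one)
    rw [coeff_one_laxSeries_one hQC, inv_one] at hr
    exact ⟨r, hr⟩
  · intro x hx b hb
    obtain ⟨r, hr⟩ := exists_inv_eq (constantCoeff_laxSeries u a₀ x b)
      (coeff_one_laxSeries_ne_zero u a₀ x b)
    exact ⟨_, r, inv_ne_zero (coeff_one_laxSeries_ne_zero u a₀ x b), hr⟩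
  · exact fun x _ b => exists_orlovSchulman_eq ν u a₀ x b
  · refine ⟨fun x _ => sub_self _, ?_, ?_, ?_, ?_, ?_, ?_⟩
    · exact fun x hx a b ha hb hab => puncture_ne (fun a => hq x a hx) (hQ x) ha₀ ha hb hab
    · exact fun x _ b => constantCoeff_laxSeries u a₀ x b
    · exact fun x _ b => coeff_one_laxSeries_ne_zero u a₀ x b
    · exact fun x _ => coeff_one_laxSeries_one hQC a₀ x
    · exact fun x hx a b ha => ⟨_, hasExpNegDeriv_leadingPhase ν (hs x hx b) a, by
        rw [comp_laxSeries, laxHom_shiftSymbol_sub (fun a => hq x a hx) (hQ x) ha₀ ha]⟩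
    · exact fun x hx j a b => ⟨_, htime x hx j a b, by
        rw [comp_laxSeries, laxHom_timeSymbol hToda hQC hx (fun a => hq x a hx) (hQ x) ha₀]⟩
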